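/- **Model.** A multigraph has labeled vertices and labeled, oriented edges; loops and multiple edges are allowed, and a loop contributes $2$ to the degree of its vertex. An $(n,m)$-multigraph has vertex labels $1,\dots,n$ and edge labels $1,\dots,m$ (so there are $n^{2m}$ of them). Let $\Delta(x)=\sum_{d\ge 0}\delta_d x^d/d!$ be a polynomial with $\delta_d\ge 0$ for all $d$, and let $\operatorname{Support}(\Delta)=\{d:\delta_d\ne 0\}$. A random $(n,m,\Delta)$-multigraph is an $(n,m)$-multigraph $G$ chosen with probability proportional to its weight $\prod_{v\in V(G)}\delta_{\deg(v)}$. Two multigraphs are isomorphic if there are bijections between their vertices and between their edges that respect endpoints; labels and orientations of edges are disregarded. A subgraph of $G$ is a set of vertices of $G$ together with a set of edges of $G$ whose endpoints are among these vertices; an $H$-subgraph of $G$ is a subgraph of $G$ isomorphic to $H$, and $G[H]$ is the number of $H$-subgraphs of $G$. For $\ell\ge 1$ let $C_\ell$ denote the cycle of length $\ell$ ($C_1$ is a loop, $C_2$ a double edge). A tree is a finite connected multigraph that contains no cycle, and a unicycle is a finite connected multigraph that contains exactly one cycle. **Theorem.** Assume that $\Delta$ is aperiodic, meaning that $\gcd\{d_1-d_2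 : \delta_{d_1}\neq 0,\ \delta_{d_2}\neq 0\}=1$. Let $m=m(n)$ be nonnegative integers such that, as $n\to\infty$, $2m/n$ converges to a limit $c$ with $\min\operatorname{Support}(\Delta)<c<\max\operatorname{Support}(\Delta)$. Then the equation $\chi\Delta'(\chi)/\Delta(\chi)=c$ has a unique positive solution $\chi$. For all large $n$ the total weight of the $(n,m)$-multigraphs is positive, so that the random $(n,m,\Delta)$-multigraph $G$ is well defined, and the following hold as $n\to\infty$. (i) For every fixed finite connected multigraph $H$ that is neither a tree nor a unicycle, the probability that $G$ has an $H$-subgraph tends to $0$. (ii) For every fixed tree $T$ with $k$ vertices and $\operatorname{aut}(T)$ automorphisms, $$\mathbb E\big(G[T]\big)\ \sim\ \frac{1}{\operatorname{aut}(T)}\,\frac{n^k}{(2m)^{k-1}}\prod_{v\in V(T)}\frac{\chi^{\deg(v)}\Delta^{(\deg(v))}(\chi)}{\Delta(\chi)}$$ (if the right-hand side is $0$, this means that $\mathbb E(G[T])=0$ for all large $n$). (iii) For every fixed $\ell\ge 1$, $G[C_\ell]$ converges in distribution to a Poisson law of mean $$\mu=\lim_{n\to\infty}\frac{1}{2\ell}\left(\frac{n}{2m}\,\frac{\chi^2\Delta''(\chi)}{\Delta(\chi)}\right)^{\ell}=\frac{1}{2\ell}\left(\frac1c\,\frac{\chi^2\Delta''(\chi)}{\Delta(\chi)}\right)^{\ell},$$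 that is, $\mathbb P\big(G[C_\ell]=t\big)\to e^{-\mu}\mu^t/t!$ for every integer $t\ge 0$. -/

import Mathlib

/-- A multigraph with vertex set `V` and edge-label set `E`: the edge labelled `e` is oriented from
`(G.ends e).1` to `(G.ends e).2`. Loops and multiple edges are allowed. The canonically labelled
`(n,m)`-multigraphs are the elements of `Multigraph (Fin n) (Fin m)`; there are `n ^ (2 * m)`. -/
@[ext]
structure Multigraph (V E : Type) where
  ends : E → V × V

namespace Multigraph

variable {V E V₁ E₁ : Type}

instance [Fintype V] [Fintype E] [DecidableEq E] : Fintype (Multigraph V E) :=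
  Fintype.ofEquiv (E → V × V) ⟨Multigraph.mk, Multigraph.ends, fun _ => rfl, fun _ => rfl⟩

/-- The degree of a vertex: the number of half-edges attached to it (a loop counts twice). -/
noncomputable def degree (G : Multigraph V E) (v : V) : ℕ :=
  Nat.card {e : E // (G.ends e).1 = v} + Nat.card {e : E // (G.ends e).2 = v}

/-- An isomorphism of multigraphs: a bijection between the vertices and a bijection between the
edges that respect endpoints. Neither the labels nor the orientations of the edges matter. -/
structure Iso (G : Multigraph V E) (H : Multigraph V₁ E₁) where
  vert : V ≃ V₁
  edge : E ≃ E₁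
  map_ends : ∀ e : E, s((H.ends (edge e)).1, (H.ends (edge e)).2) =
    s(vert (G.ends e).1, vert (G.ends e).2)

/-- The number of automorphisms of a multigraph. -/
noncomputable def aut (G : Multigraph V E) : ℕ := Nat.card (Iso G G)

/-- A subgraph of `G`: a set of vertices and a set of edges whose endpoints are among these
vertices. -/
structure Sub (G : Multigraph V E) where
  verts : Set V
  edges : Set E
  closed : ∀ e ∈ edges, (G.ends e).1 ∈ verts ∧ (G.ends e).2 ∈ verts

/-- A subgraph, seen as a multigraph in its own right. -/
def Sub.toMultigraph {G : Multigraph V E} (S : G.Sub) : Multigraph S.verts S.edges where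
  ends e := (⟨(G.ends e).1, (S.closed e e.2).1⟩, ⟨(G.ends e).2, (S.closed e e.2).2⟩)

/-- The number `G[H]` of `H`-subgraphs of `G`, that is, of subgraphs of `G` isomorphic to `H`. -/
noncomputable def count (G : Multigraph V E) (H : Multigraph V₁ E₁) : ℕ :=
  Nat.card {S : G.Sub // Nonempty (Iso S.toMultigraph H)}

/-- The cycle of length `ℓ ≥ 1`, with one edge from `i` to `i + 1` modulo `ℓ` for every `i`. It is a
loop for `ℓ = 1` and a double edge for `ℓ = 2`. -/
def cycle (ℓ : ℕ) : Multigraph (Fin ℓ) (Fin ℓ) where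
  ends i := (i, finRotate ℓ i)

/-- Connectedness (which includes having at least one vertex). -/
def Connected (G : Multigraph V E) : Prop :=
  (SimpleGraph.fromRel fun u v : V => ∃ e : E, G.ends e = (u, v)).Connected

/-- The subgraph `S` is a cycle, of some length `ℓ ≥ 1`. -/
def Sub.IsCycle {G : Multigraph V E} (S : G.Sub) : Prop :=
  ∃ ℓ : ℕ, 1 ≤ ℓ ∧ Nonempty (Iso S.toMultigraph (cycle ℓ))

/-- A tree: a connected multigraph that contains no cycle. -/
def IsTree (G : Multigraph V E) : Prop :=
  G.Connected ∧ ∀ S : G.Sub, ¬ S.IsCycle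

/-- A unicycle: a connected multigraph that contains exactly one cycle. -/
def IsUnicycle (G : Multigraph V E) : Prop :=
  G.Connected ∧ ∃! S : G.Sub, S.IsCycle

/-- The weight of `G` attached to `Δ(x) = ∑ δ_d x^d / d!`: the product over all vertices `v` of
`δ_{deg v}`, where `δ_d` is `d!` times the coefficient of `x^d` in `Δ`. -/
noncomputable def weight [Fintype V] (Δ : Polynomial ℝ) (G : Multigraph V E) : ℝ :=
  ∏ v : V, ((G.degree v).factorial : ℝ) * Δ.coeff (G.degree v)

/-- The total weight of all `(n,m)`-multigraphs. -/
noncomputable def totalWeight (Δ : Polynomial ℝ) (n m : ℕ) : ℝ :=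
  ∑ G : Multigraph (Fin n) (Fin m), weight Δ G

/-- The expectation of `f G` for a random `(n,m,Δ)`-multigraph `G`, that is, an `(n,m)`-multigraph
chosen with probability `weight Δ G / totalWeight Δ n m`. -/
noncomputable def expect (Δ : Polynomial ℝ) (n m : ℕ)
    (f : Multigraph (Fin n) (Fin m) → ℝ) : ℝ :=
  ∑ G : Multigraph (Fin n) (Fin m), weight Δ G / totalWeight Δ n m * f G

/-- The probability of the event `A` for a random `(n,m,Δ)`-multigraph. -/
noncomputable def prob (Δ : Polynomial ℝ) (n m : ℕ)
    (A : Set (Multigraph (Fin n) (Fin m))) : ℝ :=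
  expect Δ n m (A.indicator 1)

end Multigraph

/-- `Δ` is aperiodic: the gcd of all differences of two elements of its support is `1`. -/
def Polynomial.IsAperiodic (Δ : Polynomial ℝ) : Prop :=
  (Δ.support ×ˢ Δ.support).gcd (fun d : ℕ × ℕ => (d.1 : ℤ) - (d.2 : ℤ)) = 1

/-! A multigraph with m labelled oriented edges is a map from its 2m half-edges to the vertices, and
`weight` is a product of values Δ^(d)(0). By the Leibniz rule, summing over all such maps
differentiates a product: the total weight is (d/dx)^(2m) Δ^n at 0 (`totalWeight_eq`). Fixing an
embedded copy of H, with k vertices and q edges, prescribes 2q half-edges and leaves 2m - 2q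
derivations acting on ∏ Δ^(deg u) · Δ^(n-k). This makes the first moment an exact formula
(`sum_weight_mul_card_emb`), whose analytic content is a quotient of coefficients [x^(2m-2q)] P
Δ^(n-k) / [x^(2m)] Δ^n.

That quotient is found by a local limit theorem (`tendsto_scaled_coeff`). Tilt the law with
generating function Δ by r_n, chosen so that its mean is exactly 2m/n, and integrate over the circle
of radius r_n at scale 1/√n. The integrand tends to a Gaussian, and aperiodicity supplies a Gaussian
bound on the whole circle, so dominated convergence applies. Hence the expected number of embeddings
of H, divided by n^k/(2m)^q, converges to `vertexFactor` (`tendsto_expect_card_emb`).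

The three claims correspond to the sign of q - k. A connected multigraph that is neither a tree nor
a unicycle has q > k (`Connected.card_lt`), so its first moment vanishes. A tree has q = k - 1, and
its embeddings outnumber its copies by the factor aut(T). For cycles, q = k: the t-th factorial
moment counts t-tuples of distinct cycles. Disjoint tuples are embeddings of t disjoint copies of
the cycle; overlapping ones have a union with more edges than vertices and are negligible
(`Sub.ncard_verts_lt_of_overlap`, `card_overlap_le`). The factorial moments thus tend to powers of
μ, and Bonferroni's inequalities give the Poisson law (`tendsto_poisson_of_bonferroni`).

Embeddings record the reversal of each edge, so that they act on half-edges. A loop then has two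
self-embeddings but one automorphism, which makes the symmetry factor 2ℓ of a cycle correct for ℓ =
1 as well. -/

open Filter Topology

/-! ### The saddle point: existence, uniqueness, continuity. -/

namespace Polynomial

variable {Δ : Polynomial ℝ}

/-- The logarithmic derivative `x Δ'(x) / Δ(x)`, i.e. the mean of the degree distribution tilted
by `x`. -/
noncomputable def tiltedMean (Δ : Polynomial ℝ) (x : ℝ) : ℝ :=
  x * Δ.derivative.eval x / Δ.eval x

/-- The rescaled first centred moment `∑ δ_d (d - c) x ^ (d - c)`. -/
noncomputable def centredMoment (Δ : Polynomial ℝ) (c x : ℝ) : ℝ :=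
  ∑ d ∈ Δ.support, Δ.coeff d * ((d - c) * x ^ ((d : ℝ) - c))

lemma eval_pos_of_coeff_nonneg (hΔ : ∀ d, 0 ≤ Δ.coeff d) (h0 : Δ.support.Nonempty) {x : ℝ}
    (hx : 0 < x) : 0 < Δ.eval x := by
  rw [eval_eq_sum, sum_def]
  refine Finset.sum_pos (fun d hd => ?_) h0
  have : 0 < Δ.coeff d := lt_of_le_of_ne (hΔ d) (Ne.symm (mem_support_iff.1 hd))
  positivity

lemma mul_eval_derivative (Δ : Polynomial ℝ) (x : ℝ) :
    x * Δ.derivative.eval x = ∑ d ∈ Δ.support, Δ.coeff d * d * x ^ d := by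
  rw [derivative_eval, sum_def, Finset.mul_sum]
  refine Finset.sum_congr rfl fun d _ => ?_
  rcases d with _ | d
  · simp
  · simp only [Nat.add_sub_cancel, pow_succ]; ring

/-- Factoring out x^c leaves a nonnegative combination of functions s x^s with s = d - c, each of
which is monotone whatever the sign of s. The sign of mean minus c is thus that of a monotone
function. -/
lemma mul_eval_derivative_sub (Δ : Polynomial ℝ) (c : ℝ) {x : ℝ} (hx : 0 < x) :
    x * Δ.derivative.eval x - c * Δ.eval x = x ^ c * centredMoment Δ c x := by
  rw [mul_eval_derivative, eval_eq_sum, sum_def, centredMoment, Finset.mul_sum, Finset.mul_sum,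
    ← Finset.sum_sub_distrib]
  refine Finset.sum_congr rfl fun d _ => ?_
  have h : x ^ d = x ^ c * x ^ ((d : ℝ) - c) := by
    rw [← Real.rpow_add hx, add_sub_cancel, Real.rpow_natCast]
  rw [h]; ring

lemma tiltedMean_sub (hΔ : ∀ d, 0 ≤ Δ.coeff d) (h0 : Δ.support.Nonempty) (c : ℝ) {x : ℝ}
    (hx : 0 < x) : tiltedMean Δ x - c = x ^ c * centredMoment Δ c x / Δ.eval x := by
  have := eval_pos_of_coeff_nonneg hΔ h0 hx
  rw [← mul_eval_derivative_sub Δ c hx, tiltedMean]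
  field_simp

lemma strictMonoOn_mul_rpow {s : ℝ} (hs : s ≠ 0) :
    StrictMonoOn (fun x : ℝ => s * x ^ s) (Set.Ioi 0) := by
  intro x hx y hy hxy
  rcases lt_or_gt_of_ne hs with h | h
  · exact mul_lt_mul_of_neg_left (Real.rpow_lt_rpow_of_neg hx hxy h) h
  · exact mul_lt_mul_of_pos_left (Real.rpow_lt_rpow (le_of_lt hx) hxy h) h

lemma monotoneOn_mul_rpow (s : ℝ) : MonotoneOn (fun x : ℝ => s * x ^ s) (Set.Ioi 0) := by
  rcases eq_or_ne s 0 with rfl | hs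
  · intro x _ y _ _; simp
  · exact (strictMonoOn_mul_rpow hs).monotoneOn

lemma strictMonoOn_centredMoment (hΔ : ∀ d, 0 ≤ Δ.coeff d) {c : ℝ}
    (hc : ∃ d ∈ Δ.support, (d : ℝ) ≠ c) : StrictMonoOn (centredMoment Δ c) (Set.Ioi 0) := by
  intro x hx y hy hxy
  obtain ⟨d, hd, hdc⟩ := hc
  refine Finset.sum_lt_sum (fun i _ => mul_le_mul_of_nonneg_left
    (monotoneOn_mul_rpow _ hx hy hxy.le) (hΔ i)) ⟨d, hd, ?_⟩
  exact mul_lt_mul_of_pos_left (strictMonoOn_mul_rpow (sub_ne_zero.2 hdc) hx hy hxy)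
    (lt_of_le_of_ne (hΔ d) (Ne.symm (mem_support_iff.1 hd)))

/-- Centre at the mean at x: the centred moment vanishes at x and is strictly increasing, so it is
positive at y. -/
lemma strictMonoOn_tiltedMean (hΔ : ∀ d, 0 ≤ Δ.coeff d) (h2 : Δ.support.Nontrivial) :
    StrictMonoOn (tiltedMean Δ) (Set.Ioi 0) := by
  intro x hx y hy hxy
  have hex : ∃ d ∈ Δ.support, (d : ℝ) ≠ tiltedMean Δ x := by
    obtain ⟨a, ha, b, hb, hab⟩ := h2
    by_contra! h
    exact hab (Nat.cast_injective ((h a ha).trans (h b hb).symm))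
  have h0 := h2.nonempty
  have h1 := tiltedMean_sub hΔ h0 (tiltedMean Δ x) hx
  have h3 := tiltedMean_sub hΔ h0 (tiltedMean Δ x) hy
  have hm := strictMonoOn_centredMoment hΔ hex hx hy hxy
  have hE := eval_pos_of_coeff_nonneg hΔ h0 hx
  have hE' := eval_pos_of_coeff_nonneg hΔ h0 hy
  have hxp : 0 < x ^ tiltedMean Δ x := Real.rpow_pos_of_pos hx _
  have hyp : 0 < y ^ tiltedMean Δ x := Real.rpow_pos_of_pos hy _
  have hz : centredMoment Δ (tiltedMean Δ x) x = 0 := by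
    rw [sub_self, eq_comm, div_eq_zero_iff, mul_eq_zero] at h1
    rcases h1 with (h | h) | h
    · exact absurd h hxp.ne'
    · exact h
    · exact absurd h hE.ne'
  rw [hz] at hm
  have : 0 < y ^ tiltedMean Δ x * centredMoment Δ (tiltedMean Δ x) y / Δ.eval y := by positivity
  linarith

lemma continuousOn_tiltedMean (hΔ : ∀ d, 0 ≤ Δ.coeff d) (h0 : Δ.support.Nonempty) :
    ContinuousOn (tiltedMean Δ) (Set.Ioi 0) := by
  unfold tiltedMean
  refine ContinuousOn.div ?_ ?_ fun x hx => (eval_pos_of_coeff_nonneg hΔ h0 hx).ne'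
  · exact (continuous_id.mul Δ.derivative.continuous).continuousOn
  · exact Δ.continuous.continuousOn

/-- In the centred moment the term of b tends to infinity, and for x ≥ 1 every other term is at
least its value at 1. -/
lemma exists_tiltedMean_gt (hΔ : ∀ d, 0 ≤ Δ.coeff d) {c : ℝ}
    (hmax : ∃ b ∈ Δ.support, c < (b : ℝ)) : ∃ x, 0 < x ∧ c < tiltedMean Δ x := by
  obtain ⟨b, hb, hcb⟩ := hmax
  have hab : 0 < Δ.coeff b := lt_of_le_of_ne (hΔ b) (Ne.symm (mem_support_iff.1 hb))
  have ht : Tendsto (fun x : ℝ => Δ.coeff b * ((b - c) * x ^ ((b : ℝ) - c)) +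
      ∑ d ∈ Δ.support.erase b, Δ.coeff d * ((d - c) * (1 : ℝ) ^ ((d : ℝ) - c))) atTop atTop :=
    tendsto_atTop_add_const_right _ _ (((tendsto_rpow_atTop (sub_pos.2 hcb)).const_mul_atTop
      (sub_pos.2 hcb)).const_mul_atTop hab)
  obtain ⟨x, hx, hx1⟩ := ((ht.eventually_gt_atTop 0).and (eventually_ge_atTop 1)).exists
  have hx0 : (0 : ℝ) < x := by linarith
  refine ⟨x, hx0, ?_⟩
  have hG : 0 < centredMoment Δ c x := by
    rw [centredMoment, ← Finset.add_sum_erase _ _ hb]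
    refine hx.trans_le (add_le_add le_rfl (Finset.sum_le_sum fun d _ => ?_))
    exact mul_le_mul_of_nonneg_left
      (monotoneOn_mul_rpow _ (Set.mem_Ioi.2 one_pos) hx0 hx1) (hΔ d)
  have hE := eval_pos_of_coeff_nonneg hΔ ⟨b, hb⟩ hx0
  have h := tiltedMean_sub hΔ ⟨b, hb⟩ c hx0
  have : 0 < x ^ c * centredMoment Δ c x / Δ.eval x := by positivity
  linarith

/-- The mirror image of the previous bound, evaluated at y⁻¹ with y large. -/
lemma exists_tiltedMean_lt (hΔ : ∀ d, 0 ≤ Δ.coeff d) {c : ℝ}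
    (hmin : ∃ a ∈ Δ.support, (a : ℝ) < c) : ∃ x, 0 < x ∧ tiltedMean Δ x < c := by
  obtain ⟨b, hb, hcb⟩ := hmin
  have hab : 0 < Δ.coeff b := lt_of_le_of_ne (hΔ b) (Ne.symm (mem_support_iff.1 hb))
  have ht : Tendsto (fun x : ℝ => Δ.coeff b * ((c - b) * x ^ (c - (b : ℝ))) +
      -∑ d ∈ Δ.support.erase b, Δ.coeff d * ((d - c) * (1 : ℝ) ^ ((d : ℝ) - c))) atTop atTop :=
    tendsto_atTop_add_const_right _ _ (((tendsto_rpow_atTop (sub_pos.2 hcb)).const_mul_atTop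
      (sub_pos.2 hcb)).const_mul_atTop hab)
  obtain ⟨y, hy, hy1⟩ := ((ht.eventually_gt_atTop 0).and (eventually_ge_atTop 1)).exists
  have hy0 : (0 : ℝ) < y := by linarith
  have hx0 : 0 < y⁻¹ := by positivity
  refine ⟨y⁻¹, hx0, ?_⟩
  have hG : centredMoment Δ c y⁻¹ < 0 := by
    rw [centredMoment, ← Finset.add_sum_erase _ _ hb]
    have h1 : ∑ d ∈ Δ.support.erase b, Δ.coeff d * ((d - c) * y⁻¹ ^ ((d : ℝ) - c)) ≤
        ∑ d ∈ Δ.support.erase b, Δ.coeff d * ((d - c) * (1 : ℝ) ^ ((d : ℝ) - c)) :=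
      Finset.sum_le_sum fun d _ => mul_le_mul_of_nonneg_left
        (monotoneOn_mul_rpow _ hx0 (Set.mem_Ioi.2 one_pos) (inv_le_one_of_one_le₀ hy1)) (hΔ d)
    have h2 : y⁻¹ ^ ((b : ℝ) - c) = y ^ (c - (b : ℝ)) := by
      rw [Real.inv_rpow hy0.le, ← Real.rpow_neg hy0.le, neg_sub]
    rw [h2]
    nlinarith
  have hE := eval_pos_of_coeff_nonneg hΔ ⟨b, hb⟩ hx0
  have h := tiltedMean_sub hΔ ⟨b, hb⟩ c hx0
  have hp : 0 < y⁻¹ ^ c := Real.rpow_pos_of_pos hx0 _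
  have : y⁻¹ ^ c * centredMoment Δ c y⁻¹ / Δ.eval y⁻¹ < 0 :=
    div_neg_of_neg_of_pos (mul_neg_of_pos_of_neg hp hG) hE
  linarith

lemma exists_tiltedMean_eq (hΔ : ∀ d, 0 ≤ Δ.coeff d) (h0 : Δ.support.Nonempty) {c x y : ℝ}
    (hx : 0 < x) (hy : 0 < y) (hxc : tiltedMean Δ x < c) (hyc : c < tiltedMean Δ y) :
    ∃ z ∈ Set.uIcc x y, tiltedMean Δ z = c := by
  have hsub : Set.uIcc x y ⊆ Set.Ioi 0 := fun z hz => lt_of_lt_of_le (lt_min hx hy) hz.1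
  have := intermediate_value_uIcc ((continuousOn_tiltedMean hΔ h0).mono hsub)
  exact this ⟨(min_le_left _ _).trans hxc.le, hyc.le.trans (le_max_right _ _)⟩

lemma support_nontrivial {c : ℝ} (hmin : ∃ a ∈ Δ.support, (a : ℝ) < c)
    (hmax : ∃ b ∈ Δ.support, c < (b : ℝ)) : Δ.support.Nontrivial := by
  obtain ⟨a, ha, hac⟩ := hmin
  obtain ⟨b, hb, hbc⟩ := hmax
  exact ⟨a, ha, b, hb, fun h => by subst h; linarith⟩

/-- The saddle point exists and is unique. -/
theorem existsUnique_tiltedMean_eq (hΔ : ∀ d, 0 ≤ Δ.coeff d) {c : ℝ}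
    (hmin : ∃ a ∈ Δ.support, (a : ℝ) < c) (hmax : ∃ b ∈ Δ.support, c < (b : ℝ)) :
    ∃! x : ℝ, 0 < x ∧ tiltedMean Δ x = c := by
  have h2 := support_nontrivial hmin hmax
  obtain ⟨x, hx, hxc⟩ := exists_tiltedMean_lt hΔ hmin
  obtain ⟨y, hy, hyc⟩ := exists_tiltedMean_gt hΔ hmax
  obtain ⟨z, hz, hzc⟩ := exists_tiltedMean_eq hΔ h2.nonempty hx hy hxc hyc
  have hz0 : 0 < z := lt_of_lt_of_le (lt_min hx hy) hz.1
  exact ⟨z, ⟨hz0, hzc⟩, fun w hw => (strictMonoOn_tiltedMean hΔ h2).injOn hw.1 hz0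
    (hw.2.trans hzc.symm)⟩

/-- The saddle point depends continuously on the target mean. -/
theorem exists_tendsto_tiltedMean_eq (hΔ : ∀ d, 0 ≤ Δ.coeff d) (h2 : Δ.support.Nontrivial)
    {χ : ℝ} (hχ : 0 < χ) {u : ℕ → ℝ} (hu : Tendsto u atTop (𝓝 (tiltedMean Δ χ))) :
    ∃ r : ℕ → ℝ, Tendsto r atTop (𝓝 χ) ∧ ∀ᶠ n in atTop, 0 < r n ∧ tiltedMean Δ (r n) = u n := by
  classical
  have hmono := strictMonoOn_tiltedMean hΔ h2
  have key : ∀ ε, 0 < ε → ε < χ → ∀ᶠ n in atTop, ∃ z, 0 < z ∧ |z - χ| ≤ ε ∧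
      tiltedMean Δ z = u n := by
    intro ε hε hεχ
    have hl : (0 : ℝ) < χ - ε := by linarith
    have hr : (0 : ℝ) < χ + ε := by linarith
    have h1 : tiltedMean Δ (χ - ε) < tiltedMean Δ χ := hmono hl hχ (by linarith)
    have h3 : tiltedMean Δ χ < tiltedMean Δ (χ + ε) := hmono hχ hr (by linarith)
    filter_upwards [hu.eventually_const_lt h1, hu.eventually_lt_const h3] with n hn1 hn2
    obtain ⟨z, hz, hzu⟩ := exists_tiltedMean_eq hΔ h2.nonempty hl hr hn1 hn2
    rw [Set.uIcc_of_le (by linarith)] at hz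
    exact ⟨z, hl.trans_le hz.1, abs_le.2 ⟨by linarith [hz.1], by linarith [hz.2]⟩, hzu⟩
  -- The default 0 is taken only where no solution exists, which happens for finitely many n.
  let r : ℕ → ℝ := fun n => if h : ∃ z, 0 < z ∧ tiltedMean Δ z = u n then h.choose else 0
  have hr : ∀ n z, 0 < z → tiltedMean Δ z = u n → r n = z := by
    intro n z hz hzu
    have h : ∃ z, 0 < z ∧ tiltedMean Δ z = u n := ⟨z, hz, hzu⟩
    have : r n = h.choose := dif_pos h
    rw [this]
    exact hmono.injOn h.choose_spec.1 hz (h.choose_spec.2.trans hzu.symm)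
  refine ⟨r, ?_, ?_⟩
  · rw [Metric.tendsto_nhds]
    intro ε hε
    filter_upwards [key (min (ε / 2) (χ / 2)) (by positivity)
      ((min_le_right _ _).trans_lt (by linarith))] with n hn
    obtain ⟨z, hz, hzε, hzu⟩ := hn
    rw [hr n z hz hzu, Real.dist_eq]
    exact (hzε.trans (min_le_left _ _)).trans_lt (by linarith)
  · filter_upwards [key (χ / 2) (by positivity) (by linarith)] with n hn
    obtain ⟨z, hz, -, hzu⟩ := hn
    rw [hr n z hz hzu]
    exact ⟨hz, hzu⟩

end Polynomial

/-! ### Characteristic functions: decay from aperiodicity, and the central limit theorem. -/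

lemma abs_sin_natCast_mul_le (k : ℕ) (x : ℝ) : |Real.sin (k * x)| ≤ k * |Real.sin x| := by
  induction k with
  | zero => simp
  | succ k ih =>
    rw [Nat.cast_succ, add_mul, one_mul, Real.sin_add, add_mul, one_mul]
    refine (abs_add_le _ _).trans (add_le_add ?_ ?_)
    · rw [abs_mul]
      exact (mul_le_of_le_one_right (abs_nonneg _) (Real.abs_cos_le_one _)).trans ih
    · rw [abs_mul]
      exact mul_le_of_le_one_left (abs_nonneg _) (Real.abs_cos_le_one _)

lemma abs_sin_intCast_mul_le (k : ℤ) (x : ℝ) : |Real.sin (k * x)| ≤ |(k : ℝ)| * |Real.sin x| := by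
  obtain ⟨n, rfl | rfl⟩ := k.eq_nat_or_neg
  · simpa using abs_sin_natCast_mul_le n x
  · simpa using abs_sin_natCast_mul_le n x

lemma abs_sin_sum_le {ι : Type*} (s : Finset ι) (x : ι → ℝ) :
    |Real.sin (∑ i ∈ s, x i)| ≤ ∑ i ∈ s, |Real.sin (x i)| := by
  classical
  induction s using Finset.induction_on with
  | empty => simp
  | insert i s hi ih =>
    rw [Finset.sum_insert hi, Finset.sum_insert hi, Real.sin_add]
    refine (abs_add_le _ _).trans (add_le_add ?_ ?_)
    · rw [abs_mul]
      exact mul_le_of_le_one_right (abs_nonneg _) (Real.abs_cos_le_one _)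
    · rw [abs_mul]
      exact (mul_le_of_le_one_left (abs_nonneg _) (Real.abs_cos_le_one _)).trans ih

/-- Bézout writes 1 as an integer combination of the differences, so |sin x| is at most a
combination of the |sin((i - j)x)|; Cauchy–Schwarz then passes to squares. -/
lemma Polynomial.IsAperiodic.exists_sin_sq_le {Δ : Polynomial ℝ} (h : Δ.IsAperiodic) :
    ∃ κ : ℝ, 0 < κ ∧ ∀ x : ℝ, κ * Real.sin x ^ 2 ≤
      ∑ i ∈ Δ.support, ∑ j ∈ Δ.support, Real.sin (((i : ℝ) - j) * x) ^ 2 := by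
  obtain ⟨w, hw⟩ := Finset.gcd_eq_sum_mul (Δ.support ×ˢ Δ.support)
    (fun d : ℕ × ℕ => (d.1 : ℤ) - (d.2 : ℤ))
  rw [h] at hw
  set s := Δ.support ×ˢ Δ.support
  set W : ℝ := ∑ p ∈ s, (w p : ℝ) ^ 2
  have hW : 0 ≤ W := Finset.sum_nonneg fun _ _ => sq_nonneg _
  -- Using W + 1 avoids having to show that W is nonzero.
  refine ⟨(W + 1)⁻¹, by positivity, fun x => ?_⟩
  rw [← Finset.sum_product' (f := fun i j : ℕ => Real.sin (((i : ℝ) - j) * x) ^ 2)]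
  rw [inv_mul_le_iff₀ (by positivity)]
  have h1 : |Real.sin x| ≤ ∑ p ∈ s, |(w p : ℝ)| * |Real.sin (((p.1 : ℝ) - p.2) * x)| := by
    have hx : x = ∑ p ∈ s, (w p : ℝ) * (((p.1 : ℝ) - p.2) * x) := by
      have : (1 : ℝ) = ∑ p ∈ s, ((p.1 : ℝ) - p.2) * (w p : ℝ) := by exact_mod_cast hw
      calc x = 1 * x := (one_mul x).symm
        _ = _ := by
          rw [this, Finset.sum_mul]
          exact Finset.sum_congr rfl fun _ _ => by ring
    calc |Real.sin x| = |Real.sin (∑ p ∈ s, (w p : ℝ) * (((p.1 : ℝ) - p.2) * x))| := by rw [← hx]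
      _ ≤ _ := (abs_sin_sum_le _ _).trans
          (Finset.sum_le_sum fun p _ => abs_sin_intCast_mul_le _ _)
  have h2 := Finset.sum_mul_sq_le_sq_mul_sq s (fun p => |(w p : ℝ)|)
    (fun p => |Real.sin (((p.1 : ℝ) - p.2) * x)|)
  simp only [sq_abs] at h2
  have h3 : Real.sin x ^ 2 ≤ (∑ p ∈ s, |(w p : ℝ)| * |Real.sin (((p.1 : ℝ) - p.2) * x)|) ^ 2 := by
    rw [← sq_abs (Real.sin x)]
    exact pow_le_pow_left₀ (abs_nonneg _) h1 2
  have h4 : 0 ≤ ∑ p ∈ s, Real.sin (((p.1 : ℝ) - p.2) * x) ^ 2 :=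
    Finset.sum_nonneg fun _ _ => sq_nonneg _
  have h5 := h3.trans h2
  nlinarith

/-- Jordan's inequality sin u ≥ 2u/π on [0, π/2], at u = |θ|/2. -/
lemma sq_div_pi_sq_le_sin_sq {θ : ℝ} (hθ : |θ| ≤ Real.pi) :
    θ ^ 2 / Real.pi ^ 2 ≤ Real.sin (θ / 2) ^ 2 := by
  have hpi := Real.pi_pos
  have h1 : |θ| / Real.pi ≤ Real.sin (|θ| / 2) := by
    have := Real.mul_le_sin (x := |θ| / 2) (by positivity) (by linarith)
    refine le_trans (le_of_eq ?_) this
    field_simp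
  have h2 : Real.sin (|θ| / 2) ^ 2 = Real.sin (θ / 2) ^ 2 := by
    rcases abs_cases θ with ⟨h, -⟩ | ⟨h, -⟩ <;> rw [h]
    rw [neg_div, Real.sin_neg, neg_sq]
  rw [← h2, ← sq_abs θ, ← div_pow]
  exact pow_le_pow_left₀ (by positivity) h1 2

/-- The squared modulus of a characteristic function on a finite set of integers. -/
lemma norm_sq_sum_exp (s : Finset ℕ) (p : ℕ → ℝ) (hp : ∑ i ∈ s, p i = 1) (θ : ℝ) :
    ‖∑ i ∈ s, (p i : ℂ) * Complex.exp ((i * θ : ℝ) * Complex.I)‖ ^ 2 =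
      1 - 2 * ∑ i ∈ s, ∑ j ∈ s, p i * p j * Real.sin (((i : ℝ) - j) * (θ / 2)) ^ 2 := by
  have hre : (∑ i ∈ s, (p i : ℂ) * Complex.exp ((i * θ : ℝ) * Complex.I)).re =
      ∑ i ∈ s, p i * Real.cos (i * θ) := by
    rw [Complex.re_sum]
    exact Finset.sum_congr rfl fun i _ => by rw [Complex.re_ofReal_mul, Complex.exp_ofReal_mul_I_re]
  have him : (∑ i ∈ s, (p i : ℂ) * Complex.exp ((i * θ : ℝ) * Complex.I)).im =
      ∑ i ∈ s, p i * Real.sin (i * θ) := by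
    rw [Complex.im_sum]
    exact Finset.sum_congr rfl fun i _ => by rw [Complex.im_ofReal_mul, Complex.exp_ofReal_mul_I_im]
  have h1 : (1 : ℝ) = ∑ i ∈ s, ∑ j ∈ s, p i * p j := by
    rw [← Finset.sum_mul_sum, hp, one_mul]
  rw [← Complex.normSq_eq_norm_sq, Complex.normSq_apply, hre, him, Finset.sum_mul_sum,
    Finset.sum_mul_sum, ← Finset.sum_add_distrib]
  conv_rhs => rw [h1, Finset.mul_sum, ← Finset.sum_sub_distrib]
  refine Finset.sum_congr rfl fun i _ => ?_
  rw [← Finset.sum_add_distrib, Finset.mul_sum, ← Finset.sum_sub_distrib]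
  refine Finset.sum_congr rfl fun j _ => ?_
  have h2 : Real.cos (i * θ - j * θ) =
      1 - 2 * Real.sin (((i : ℝ) - j) * (θ / 2)) ^ 2 := by
    rw [show (i : ℝ) * θ - j * θ = 2 * (((i : ℝ) - j) * (θ / 2)) by ring, Real.cos_two_mul,
      Real.cos_sq']
    ring
  rw [Real.cos_sub] at h2
  linear_combination p i * p j * h2

/-- An aperiodic characteristic function decays like a Gaussian near the origin. -/
lemma Polynomial.IsAperiodic.exists_norm_le {Δ : Polynomial ℝ} (h : Δ.IsAperiodic) {p₀ : ℝ}
    (hp₀ : 0 < p₀) : ∃ κ : ℝ, 0 < κ ∧ ∀ p : ℕ → ℝ, (∑ i ∈ Δ.support, p i = 1) →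
      (∀ i ∈ Δ.support, p₀ ≤ p i) → ∀ θ : ℝ, |θ| ≤ Real.pi →
      ‖∑ i ∈ Δ.support, (p i : ℂ) * Complex.exp ((i * θ : ℝ) * Complex.I)‖ ≤
        Real.exp (-(κ * θ ^ 2)) := by
  obtain ⟨κ, hκ, hsin⟩ := h.exists_sin_sq_le
  have hpi := Real.pi_pos
  -- The squared modulus is at most 1 - 2 p₀² κ sin²(θ/2) ≤ 1 - 2 p₀² κ θ²/π², hence at most the
  -- exponential of -2 p₀² κ θ²/π²; the square root halves the exponent.
  refine ⟨p₀ ^ 2 * κ / Real.pi ^ 2, by positivity, fun p hp hpp θ hθ => ?_⟩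
  refine le_of_sq_le_sq ?_ (Real.exp_pos _).le
  rw [norm_sq_sum_exp _ _ hp, ← Real.exp_nat_mul]
  have h1 : p₀ ^ 2 * ∑ i ∈ Δ.support, ∑ j ∈ Δ.support, Real.sin (((i : ℝ) - j) * (θ / 2)) ^ 2 ≤
      ∑ i ∈ Δ.support, ∑ j ∈ Δ.support, p i * p j * Real.sin (((i : ℝ) - j) * (θ / 2)) ^ 2 := by
    rw [Finset.mul_sum]
    refine Finset.sum_le_sum fun i hi => ?_
    rw [Finset.mul_sum]
    refine Finset.sum_le_sum fun j hj => mul_le_mul_of_nonneg_right ?_ (sq_nonneg _)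
    rw [sq]
    exact mul_le_mul (hpp i hi) (hpp j hj) hp₀.le (hp₀.le.trans (hpp i hi))
  have h2 := mul_le_mul_of_nonneg_left (hsin (θ / 2)) (sq_nonneg p₀)
  have h3 := mul_le_mul_of_nonneg_left (sq_div_pi_sq_le_sin_sq hθ) (by positivity : 0 ≤ p₀ ^ 2 * κ)
  have h4 := Real.add_one_le_exp (((2 : ℕ) : ℝ) * -(p₀ ^ 2 * κ / Real.pi ^ 2 * θ ^ 2))
  have h5 : p₀ ^ 2 * κ * (θ ^ 2 / Real.pi ^ 2) = p₀ ^ 2 * κ / Real.pi ^ 2 * θ ^ 2 := by ring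
  push_cast at h4 ⊢
  nlinarith

/-- Second-order Taylor expansion of exp(iw) at w = x_n/√n: the quadratic term times n is -x_n²/2,
and the cubic remainder times n is at most x_n² |w|, which tends to 0. -/
lemma tendsto_mul_exp_sub_one_sub {x : ℕ → ℝ} {y : ℝ} (hx : Tendsto x atTop (𝓝 y)) :
    Tendsto (fun n : ℕ => (n : ℂ) * (Complex.exp ((x n / √n : ℝ) * Complex.I) - 1 -
      (x n / √n : ℝ) * Complex.I)) atTop (𝓝 ((-(y ^ 2 / 2) : ℝ) : ℂ)) := by
  have hs : Tendsto (fun n : ℕ => √(n : ℝ)) atTop atTop :=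
    Real.tendsto_sqrt_atTop.comp tendsto_natCast_atTop_atTop
  have hw : Tendsto (fun n : ℕ => x n / √n) atTop (𝓝 0) := hx.div_atTop hs
  have hmain : Tendsto (fun n : ℕ => ((-(x n ^ 2 / 2) : ℝ) : ℂ)) atTop
      (𝓝 ((-(y ^ 2 / 2) : ℝ) : ℂ)) :=
    (Complex.continuous_ofReal.tendsto _).comp ((hx.pow 2).div_const 2).neg
  refine (tendsto_iff_of_dist ?_).2 hmain
  have hz : Tendsto (fun n : ℕ => |x n| ^ 2 * |x n / √n|) atTop (𝓝 0) := by
    have := (hx.abs.pow 2).mul hw.abs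
    simpa using this
  refine squeeze_zero' (Eventually.of_forall fun _ => dist_nonneg) ?_ hz
  have hw1 : ∀ᶠ n : ℕ in atTop, |x n / √n| < 1 := by
    have := hw.abs
    rw [abs_zero] at this
    exact this.eventually_lt_const one_pos
  filter_upwards [hw1, eventually_gt_atTop 0] with n hn hn0
  have hsq : √(n : ℝ) ^ 2 = n := Real.sq_sqrt (Nat.cast_nonneg n)
  have hspos : 0 < √(n : ℝ) := Real.sqrt_pos.2 (Nat.cast_pos.2 hn0)
  set w : ℝ := x n / √n with hwdef
  have hxw : x n = w * √n := by rw [hwdef]; field_simp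
  have hb := Complex.exp_bound (x := (w : ℂ) * Complex.I) (by simpa using hn.le)
    (n := 3) (by norm_num)
  rw [dist_eq_norm]
  have heq : (n : ℂ) * (Complex.exp (w * Complex.I) - 1 - w * Complex.I) -
      ((-(x n ^ 2 / 2) : ℝ) : ℂ) = n * (Complex.exp (w * Complex.I) -
        ∑ i ∈ Finset.range 3, ((w : ℂ) * Complex.I) ^ i / (i.factorial : ℂ)) := by
    have hn2 : (n : ℂ) = (√n : ℂ) ^ 2 := by exact_mod_cast congrArg ((↑) : ℝ → ℂ) hsq.symm
    simp only [Finset.sum_range_succ, Finset.range_zero, Finset.sum_empty, pow_zero, pow_one,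
      mul_pow, Complex.I_sq, Nat.factorial]
    rw [hxw, hn2]
    push_cast
    ring
  rw [heq, norm_mul, Complex.norm_natCast]
  have hnw : ‖(w : ℂ) * Complex.I‖ = |w| := by simp
  rw [hnw] at hb
  calc (n : ℝ) * _ ≤ n * (|w| ^ 3 * ((Nat.succ 3 : ℕ) * ((Nat.factorial 3 : ℕ) * (3 : ℕ) : ℝ)⁻¹)) :=
        mul_le_mul_of_nonneg_left hb (Nat.cast_nonneg n)
    _ ≤ n * |w| ^ 3 := by
        refine mul_le_mul_of_nonneg_left (mul_le_of_le_one_right (by positivity) ?_)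
          (Nat.cast_nonneg n)
        norm_num [Nat.factorial]
    _ = |x n| ^ 2 * |w| := by
        rw [hxw, abs_mul, abs_of_pos hspos, mul_pow, hsq]; ring

/-- The central limit theorem for the characteristic functions of a convergent sequence of centred
laws on a fixed finite set. -/
lemma tendsto_charFun_pow (s : Finset ℕ) {p : ℕ → ℕ → ℝ} {q : ℕ → ℝ} {c : ℕ → ℝ} {c' : ℝ}
    (hp : ∀ d ∈ s, Tendsto (fun n => p n d) atTop (𝓝 (q d))) (hc : Tendsto c atTop (𝓝 c'))
    (h1 : ∀ᶠ n in atTop, ∑ d ∈ s, p n d = 1)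
    (h0 : ∀ᶠ n in atTop, ∑ d ∈ s, p n d * ((d : ℝ) - c n) = 0) (t : ℝ) :
    Tendsto (fun n : ℕ => (∑ d ∈ s, (p n d : ℂ) *
      Complex.exp ((((d : ℝ) - c n) * t / √n : ℝ) * Complex.I)) ^ n) atTop
      (𝓝 (Complex.exp ((-(∑ d ∈ s, q d * ((d : ℝ) - c') ^ 2) * t ^ 2 / 2 : ℝ) : ℂ))) := by
  have key : Tendsto (fun n : ℕ => (n : ℂ) * (∑ d ∈ s, (p n d : ℂ) *
      Complex.exp ((((d : ℝ) - c n) * t / √n : ℝ) * Complex.I) - 1)) atTop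
      (𝓝 ((-(∑ d ∈ s, q d * ((d : ℝ) - c') ^ 2) * t ^ 2 / 2 : ℝ) : ℂ)) := by
    have hsum : Tendsto (fun n : ℕ => ∑ d ∈ s, (p n d : ℂ) * ((n : ℂ) *
        (Complex.exp ((((d : ℝ) - c n) * t / √n : ℝ) * Complex.I) - 1 -
        (((d : ℝ) - c n) * t / √n : ℝ) * Complex.I))) atTop
        (𝓝 (∑ d ∈ s, (q d : ℂ) * ((-((((d : ℝ) - c') * t) ^ 2 / 2) : ℝ) : ℂ))) := by
      refine tendsto_finsetSum _ fun d hd => Tendsto.mul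
        ((Complex.continuous_ofReal.tendsto _).comp (hp d hd)) ?_
      exact tendsto_mul_exp_sub_one_sub ((tendsto_const_nhds.sub hc).mul_const t)
    have hlim : (∑ d ∈ s, (q d : ℂ) * ((-((((d : ℝ) - c') * t) ^ 2 / 2) : ℝ) : ℂ)) =
        ((-(∑ d ∈ s, q d * ((d : ℝ) - c') ^ 2) * t ^ 2 / 2 : ℝ) : ℂ) := by
      push_cast
      rw [← Finset.sum_neg_distrib, Finset.sum_mul, Finset.sum_div]
      exact Finset.sum_congr rfl fun d _ => by ring
    rw [hlim] at hsum
    refine hsum.congr' ?_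
    filter_upwards [h1, h0] with n hn1 hn0
    have e1 : (∑ d ∈ s, (p n d : ℂ)) = 1 := by exact_mod_cast hn1
    have e0 : (∑ d ∈ s, (p n d : ℂ) * ((d : ℂ) - c n)) = 0 := by exact_mod_cast hn0
    -- Exact centring removes the first-order term, which would otherwise be of order √n.
    have e2 : ∑ d ∈ s, (p n d : ℂ) * ((n : ℂ) * ((((d : ℝ) - c n) * t / √n : ℝ) * Complex.I)) =
        0 := by
      calc _ = (n : ℂ) * (t / √n : ℝ) * Complex.I * ∑ d ∈ s, (p n d : ℂ) * ((d : ℂ) - c n) := by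
            rw [Finset.mul_sum]
            refine Finset.sum_congr rfl fun d _ => ?_
            push_cast; ring
        _ = 0 := by rw [e0, mul_zero]
    calc _ = ∑ d ∈ s, ((n : ℂ) * ((p n d : ℂ) *
          Complex.exp ((((d : ℝ) - c n) * t / √n : ℝ) * Complex.I)) - n * (p n d : ℂ) -
          (p n d : ℂ) * ((n : ℂ) * ((((d : ℝ) - c n) * t / √n : ℝ) * Complex.I))) :=
          Finset.sum_congr rfl fun d _ => by ring
      _ = _ := by
          rw [Finset.sum_sub_distrib, Finset.sum_sub_distrib, e2, ← Finset.mul_sum,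
            ← Finset.mul_sum, e1]
          ring
  have := Complex.tendsto_one_add_pow_exp_of_tendsto key
  simpa using this

/-! ### The local limit theorem for coefficients of P Δ^j, from Cauchy's integral. -/

/-- Cauchy's formula for the coefficients of a polynomial. -/
lemma integral_eval_mul_exp (Q : Polynomial ℝ) (r : ℝ) (M : ℕ) :
    ∫ θ in -Real.pi..Real.pi, (Q.map Complex.ofRealHom).eval (r * Complex.exp (θ * Complex.I)) *
      Complex.exp (-(M * θ * Complex.I)) = ((2 * Real.pi * (Q.coeff M * r ^ M) : ℝ) : ℂ) := by
  have hterm : ∀ j : ℕ, ∫ θ : ℝ in -Real.pi..Real.pi,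
      Complex.exp (((j : ℂ) - M) * Complex.I * θ) = if j = M then ((2 * Real.pi : ℝ) : ℂ) else 0 := by
    intro j
    split_ifs with h
    · subst h
      simp
      ring
    · have hne : ((j : ℂ) - M) * Complex.I ≠ 0 :=
        mul_ne_zero (sub_ne_zero.2 (by exact_mod_cast h)) Complex.I_ne_zero
      rw [integral_exp_mul_complex hne, div_eq_zero_iff]
      left
      rw [sub_eq_zero, Complex.exp_eq_exp_iff_exists_int]
      refine ⟨(j : ℤ) - M, ?_⟩
      push_cast
      ring
  have hfun : ∀ θ : ℝ, (Q.map Complex.ofRealHom).eval (r * Complex.exp (θ * Complex.I)) *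
      Complex.exp (-(M * θ * Complex.I)) = ∑ j ∈ Q.support, ((Q.coeff j * r ^ j : ℝ) : ℂ) *
        Complex.exp (((j : ℂ) - M) * Complex.I * θ) := by
    intro θ
    rw [Polynomial.eval_map, Polynomial.eval₂_eq_sum, Polynomial.sum_def, Finset.sum_mul]
    refine Finset.sum_congr rfl fun j _ => ?_
    rw [mul_pow, ← Complex.exp_nat_mul, mul_assoc, mul_assoc, ← Complex.exp_add]
    simp only [Complex.ofRealHom_eq_coe, Complex.ofReal_mul, Complex.ofReal_pow, mul_assoc]
    congr 4
    ring
  simp_rw [hfun]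
  rw [intervalIntegral.integral_finsetSum]
  · simp_rw [intervalIntegral.integral_const_mul, hterm]
    simp only [mul_ite, mul_zero]
    rw [Finset.sum_ite_eq' Q.support M]
    split_ifs with h
    · push_cast; ring
    · rw [Polynomial.notMem_support_iff.1 h]; simp
  · intro j _
    exact Continuous.intervalIntegrable (by fun_prop) _ _

namespace Polynomial

variable {Δ : Polynomial ℝ}

/-- The law with generating function `Δ`, tilted by `r`. -/
noncomputable def tilt (Δ : Polynomial ℝ) (r : ℝ) (d : ℕ) : ℝ := Δ.coeff d * r ^ d / Δ.eval r

lemma sum_tilt {r : ℝ} (hr : Δ.eval r ≠ 0) : ∑ d ∈ Δ.support, Δ.tilt r d = 1 := by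
  simp only [tilt]
  rw [← Finset.sum_div, div_eq_one_iff_eq hr, eval_eq_sum, sum_def]

lemma sum_tilt_mul_sub {r : ℝ} (hr : Δ.eval r ≠ 0) :
    ∑ d ∈ Δ.support, Δ.tilt r d * ((d : ℝ) - Δ.tiltedMean r) = 0 := by
  simp_rw [mul_sub]
  rw [Finset.sum_sub_distrib, ← Finset.sum_mul, sum_tilt hr, one_mul, tiltedMean,
    mul_eval_derivative, Finset.sum_div, sub_eq_zero]
  exact Finset.sum_congr rfl fun d _ => by rw [tilt]; ring

lemma eval_map_mul_exp (P : Polynomial ℝ) (r θ : ℝ) :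
    (P.map Complex.ofRealHom).eval (r * Complex.exp (θ * Complex.I)) =
      ∑ d ∈ P.support, ((P.coeff d * r ^ d : ℝ) : ℂ) * Complex.exp ((d * θ : ℝ) * Complex.I) := by
  rw [eval_map, eval₂_eq_sum, sum_def]
  refine Finset.sum_congr rfl fun j _ => ?_
  rw [mul_pow, ← Complex.exp_nat_mul]
  simp only [Complex.ofRealHom_eq_coe, Complex.ofReal_mul, Complex.ofReal_pow, mul_assoc,
    Complex.ofReal_natCast]

lemma norm_eval_map_mul_exp_le (P : Polynomial ℝ) (r θ : ℝ) :
    ‖(P.map Complex.ofRealHom).eval (r * Complex.exp (θ * Complex.I))‖ ≤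
      ∑ d ∈ P.support, |P.coeff d * r ^ d| := by
  rw [eval_map_mul_exp]
  refine (norm_sum_le _ _).trans (Finset.sum_le_sum fun d _ => ?_)
  rw [norm_mul, Complex.norm_exp_ofReal_mul_I, mul_one, Complex.norm_real, Real.norm_eq_abs]

lemma eval_map_mul_exp_eq_tilt {r : ℝ} (hr : Δ.eval r ≠ 0) (θ : ℝ) :
    (Δ.map Complex.ofRealHom).eval (r * Complex.exp (θ * Complex.I)) = Δ.eval r *
      ∑ d ∈ Δ.support, (Δ.tilt r d : ℂ) * Complex.exp ((d * θ : ℝ) * Complex.I) := by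
  rw [eval_map_mul_exp, Finset.mul_sum]
  refine Finset.sum_congr rfl fun d _ => ?_
  rw [← mul_assoc, ← Complex.ofReal_mul]
  congr 2
  rw [tilt]; field_simp

/-- The integrand, after rescaling, of Cauchy's formula for `[x^M] P Δ^j`. -/
noncomputable def cauchyIntegrand (Δ P : Polynomial ℝ) (r : ℝ) (n j M : ℕ) (t : ℝ) : ℂ :=
  (P.map Complex.ofRealHom).eval (r * Complex.exp ((t / √n : ℝ) * Complex.I)) *
    (∑ d ∈ Δ.support, (Δ.tilt r d : ℂ) * Complex.exp ((d * (t / √n) : ℝ) * Complex.I)) ^ j *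
    Complex.exp (-(M * (t / √n : ℝ) * Complex.I))

lemma continuous_cauchyIntegrand (Δ P : Polynomial ℝ) (r : ℝ) (n j M : ℕ) :
    Continuous (cauchyIntegrand Δ P r n j M) := by
  unfold cauchyIntegrand
  refine Continuous.mul (Continuous.mul ?_ ?_) ?_
  · exact (P.map Complex.ofRealHom).continuous.comp (by fun_prop)
  · fun_prop
  · fun_prop

/-- Cauchy's formula after the substitution θ = t/√n. The indicator extends the integral to the
whole line, so that dominated convergence can be used although the interval grows with n. -/
lemma coeff_mul_pow_eq_integral (P : Polynomial ℝ) {r : ℝ} (hr : Δ.eval r ≠ 0)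
    {n : ℕ} (hn : 0 < n) (j M : ℕ) :
    ((√n * (2 * Real.pi * ((P * Δ ^ j).coeff M * r ^ M)) / Δ.eval r ^ j : ℝ) : ℂ) =
      ∫ t : ℝ, (Set.Ioc (-(Real.pi * √n)) (Real.pi * √n)).indicator
        (cauchyIntegrand Δ P r n j M) t := by
  have hs : 0 < √(n : ℝ) := Real.sqrt_pos.2 (Nat.cast_pos.2 hn)
  have hpi := Real.pi_pos
  rw [MeasureTheory.integral_indicator measurableSet_Ioc,
    ← intervalIntegral.integral_of_le (by nlinarith [mul_pos hpi hs])]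
  set g : ℝ → ℂ := fun θ => (P.map Complex.ofRealHom).eval (r * Complex.exp (θ * Complex.I)) *
    (∑ d ∈ Δ.support, (Δ.tilt r d : ℂ) * Complex.exp ((d * θ : ℝ) * Complex.I)) ^ j *
    Complex.exp (-(M * θ * Complex.I)) with hg
  have h1 : ∀ t, cauchyIntegrand Δ P r n j M t = g (t / √n) := fun t => rfl
  simp_rw [h1]
  rw [intervalIntegral.integral_comp_div _ hs.ne', neg_div,
    mul_div_cancel_right₀ _ hs.ne']
  have h2 : ∀ θ : ℝ, ((P * Δ ^ j).map Complex.ofRealHom).eval (r * Complex.exp (θ * Complex.I)) *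
      Complex.exp (-(M * θ * Complex.I)) = ((Δ.eval r : ℝ) : ℂ) ^ j * g θ := by
    intro θ
    rw [hg]
    simp only
    rw [Polynomial.map_mul, Polynomial.map_pow, eval_mul, eval_pow, eval_map_mul_exp_eq_tilt hr]
    ring
  have h3 := integral_eval_mul_exp (P * Δ ^ j) r M
  simp_rw [h2] at h3
  rw [intervalIntegral.integral_const_mul] at h3
  have hr' : ((Δ.eval r : ℝ) : ℂ) ^ j ≠ 0 := pow_ne_zero _ (by exact_mod_cast hr)
  have h4 : ∫ θ in -Real.pi..Real.pi, g θ =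
      ((2 * Real.pi * ((P * Δ ^ j).coeff M * r ^ M) : ℝ) : ℂ) / ((Δ.eval r : ℝ) : ℂ) ^ j := by
    rw [eq_div_iff hr', mul_comm, h3]
  rw [h4, Complex.real_smul]
  push_cast
  ring

/-- The variance of the tilted law. -/
noncomputable def tiltedVariance (Δ : Polynomial ℝ) (r : ℝ) : ℝ :=
  ∑ d ∈ Δ.support, Δ.tilt r d * ((d : ℝ) - Δ.tiltedMean r) ^ 2

lemma tilt_pos (hΔ : ∀ d, 0 ≤ Δ.coeff d) {r : ℝ} (hr : 0 < r) {d : ℕ} (hd : d ∈ Δ.support) :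
    0 < Δ.tilt r d := by
  have h := eval_pos_of_coeff_nonneg hΔ ⟨d, hd⟩ hr
  have : 0 < Δ.coeff d := lt_of_le_of_ne (hΔ d) (Ne.symm (mem_support_iff.1 hd))
  unfold tilt
  positivity

lemma tiltedVariance_pos (hΔ : ∀ d, 0 ≤ Δ.coeff d) (h2 : Δ.support.Nontrivial) {r : ℝ}
    (hr : 0 < r) : 0 < Δ.tiltedVariance r := by
  have hex : ∃ d ∈ Δ.support, (d : ℝ) ≠ tiltedMean Δ r := by
    obtain ⟨a, ha, b, hb, hab⟩ := h2
    by_contra! h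
    exact hab (Nat.cast_injective ((h a ha).trans (h b hb).symm))
  obtain ⟨d, hd, hne⟩ := hex
  refine Finset.sum_pos' (fun i hi => mul_nonneg (tilt_pos hΔ hr hi).le (sq_nonneg _)) ⟨d, hd, ?_⟩
  exact mul_pos (tilt_pos hΔ hr hd) (by have := sub_ne_zero.2 hne; positivity)

lemma tendsto_tilt {r : ℕ → ℝ} {χ : ℝ} (hr : Tendsto r atTop (𝓝 χ)) (hχ : Δ.eval χ ≠ 0) (d : ℕ) :
    Tendsto (fun n => Δ.tilt (r n) d) atTop (𝓝 (Δ.tilt χ d)) :=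
  ((hr.pow d).const_mul _).div ((Δ.continuous.tendsto χ).comp hr) hχ

/-- Since the mean is exactly N/n, the phase exp(-iNθ) is what centres the n-th power of the
characteristic function, and the central limit theorem applies. The lags cost only k factors and one
phase exp(iaθ), all tending to 1 because θ = t/√n tends to 0. -/
lemma tendsto_cauchyIntegrand {r : ℕ → ℝ} {χ : ℝ} (hr : Tendsto r atTop (𝓝 χ))
    (hχ : Δ.eval χ ≠ 0) {N : ℕ → ℕ} (hmean : Tendsto (fun n => Δ.tiltedMean (r n)) atTop
      (𝓝 (Δ.tiltedMean χ))) (hN : ∀ᶠ n in atTop, Δ.tiltedMean (r n) = (N n : ℝ) / n)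
    (hN' : Tendsto N atTop atTop) (P : Polynomial ℝ) (k a : ℕ) (t : ℝ) :
    Tendsto (fun n => cauchyIntegrand Δ P (r n) n (n - k) (N n - a) t) atTop
      (𝓝 ((P.eval χ * Real.exp (-(Δ.tiltedVariance χ) * t ^ 2 / 2) : ℝ) : ℂ)) := by
  have hs : Tendsto (fun n : ℕ => √(n : ℝ)) atTop atTop :=
    Real.tendsto_sqrt_atTop.comp tendsto_natCast_atTop_atTop
  have hθ : Tendsto (fun n : ℕ => t / √(n : ℝ)) atTop (𝓝 0) := tendsto_const_nhds.div_atTop hs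
  have hexp : ∀ b : ℝ, Tendsto (fun n : ℕ => Complex.exp ((b * (t / √n) : ℝ) * Complex.I)) atTop
      (𝓝 1) := by
    intro b
    have h : Continuous fun x : ℝ => Complex.exp ((b * x : ℝ) * Complex.I) := by fun_prop
    have := (h.tendsto 0).comp hθ
    simpa [Function.comp_def] using this
  have hev : ∀ᶠ n in atTop, Δ.eval (r n) ≠ 0 :=
    ((Δ.continuous.tendsto χ).comp hr).eventually_ne hχ
  have hcl := tendsto_charFun_pow Δ.support (fun d _ => tendsto_tilt hr hχ d) hmean
    (hev.mono fun n hn => sum_tilt hn) (hev.mono fun n hn => sum_tilt_mul_sub hn) t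
  set φ : ℕ → ℂ := fun n => ∑ d ∈ Δ.support, (Δ.tilt (r n) d : ℂ) *
    Complex.exp ((d * (t / √n) : ℝ) * Complex.I) with hφdef
  have hφ : Tendsto φ atTop (𝓝 1) := by
    have h : Tendsto φ atTop (𝓝 (∑ d ∈ Δ.support, (Δ.tilt χ d : ℂ) * 1)) :=
      tendsto_finsetSum _ fun d _ => ((Complex.continuous_ofReal.tendsto _).comp
        (tendsto_tilt hr hχ d)).mul (hexp d)
    have h1 : (∑ d ∈ Δ.support, (Δ.tilt χ d : ℂ) * 1) = 1 := by
      simp only [mul_one]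
      exact_mod_cast sum_tilt hχ
    rwa [h1] at h
  have hP : Tendsto (fun n : ℕ => (P.map Complex.ofRealHom).eval
      (r n * Complex.exp ((t / √n : ℝ) * Complex.I))) atTop (𝓝 ((P.eval χ : ℝ) : ℂ)) := by
    have h1 : Tendsto (fun n : ℕ => (r n : ℂ) * Complex.exp ((t / √n : ℝ) * Complex.I)) atTop
        (𝓝 ((χ : ℂ) * 1)) := by
      refine ((Complex.continuous_ofReal.tendsto _).comp hr).mul ?_
      simpa using hexp 1
    have h2 := ((P.map Complex.ofRealHom).continuous.tendsto _).comp h1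
    rw [mul_one] at h2
    have h3 : (P.map Complex.ofRealHom).eval (χ : ℂ) = ((P.eval χ : ℝ) : ℂ) := by
      rw [eval_map]
      exact eval₂_at_apply Complex.ofRealHom χ
    rwa [h3] at h2
  have hall := (hP.mul (hcl.div (hφ.pow k) (by simp))).mul (hexp a)
  simp only [one_pow, div_one, mul_one] at hall
  have hlim : ((P.eval χ * Real.exp (-(Δ.tiltedVariance χ) * t ^ 2 / 2) : ℝ) : ℂ) =
      ((P.eval χ : ℝ) : ℂ) * Complex.exp ((-(∑ d ∈ Δ.support, Δ.tilt χ d *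
        ((d : ℝ) - Δ.tiltedMean χ) ^ 2) * t ^ 2 / 2 : ℝ) : ℂ) := by
    rw [tiltedVariance]; push_cast; rfl
  rw [hlim]
  refine hall.congr' ?_
  filter_upwards [hN, hφ.eventually_ne one_ne_zero, eventually_ge_atTop k,
    hN'.eventually_ge_atTop a, eventually_gt_atTop 0] with n hn hφn hnk hna hn0
  rw [cauchyIntegrand]
  change _ = _ * φ n ^ (n - k) * _
  have h5 : (∑ d ∈ Δ.support, (Δ.tilt (r n) d : ℂ) *
      Complex.exp ((((d : ℝ) - Δ.tiltedMean (r n)) * t / √n : ℝ) * Complex.I)) ^ n =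
      φ n ^ n * Complex.exp (-(N n * (t / √n : ℝ) * Complex.I)) := by
    have h6 : ∑ d ∈ Δ.support, (Δ.tilt (r n) d : ℂ) *
        Complex.exp ((((d : ℝ) - Δ.tiltedMean (r n)) * t / √n : ℝ) * Complex.I) =
        φ n * Complex.exp (-(((N n : ℝ) / n * (t / √n) : ℝ) * Complex.I)) := by
      rw [hφdef]
      simp only
      rw [Finset.sum_mul]
      refine Finset.sum_congr rfl fun d _ => ?_
      rw [mul_assoc, ← Complex.exp_add, hn]
      congr 2
      push_cast; ring
    rw [h6, mul_pow, ← Complex.exp_nat_mul]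
    congr 2
    have : (n : ℂ) ≠ 0 := by exact_mod_cast hn0.ne'
    push_cast
    field_simp
  rw [Pi.div_apply, h5]
  have h7 : φ n ^ n = φ n ^ (n - k) * φ n ^ k := by rw [← pow_add, Nat.sub_add_cancel hnk]
  have h8 : φ n ^ k ≠ 0 := pow_ne_zero _ hφn
  have h9 : Complex.exp (-(N n * (t / √n : ℝ) * Complex.I)) *
      Complex.exp ((a * (t / √n) : ℝ) * Complex.I) =
      Complex.exp (-((N n - a : ℕ) * (t / √n : ℝ) * Complex.I)) := by
    rw [← Complex.exp_add, Nat.cast_sub hna]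
    congr 1
    push_cast; ring
  rw [h7, ← h9]
  field_simp

/-- The local limit theorem, for all lags and perturbations at once. -/
theorem tendsto_scaled_coeff (hΔ : ∀ d, 0 ≤ Δ.coeff d) (haper : Δ.IsAperiodic)
    (h2 : Δ.support.Nontrivial) {χ : ℝ} (hχ : 0 < χ) {N : ℕ → ℕ}
    (hN : Tendsto (fun n => (N n : ℝ) / n) atTop (𝓝 (Δ.tiltedMean χ)))
    (hN' : Tendsto N atTop atTop) :
    ∃ (s : ℕ → ℝ) (J : ℝ), 0 < J ∧ (∀ᶠ n in atTop, 0 < s n) ∧ ∀ (P : Polynomial ℝ) (k a : ℕ),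
      Tendsto (fun n => s n * (P * Δ ^ (n - k)).coeff (N n - a)) atTop
        (𝓝 (J * (P.eval χ * (χ ^ a / Δ.eval χ ^ k)))) := by
  obtain ⟨r, hr, hrN⟩ := exists_tendsto_tiltedMean_eq hΔ h2 hχ hN
  have hpi := Real.pi_pos
  have hEχ := eval_pos_of_coeff_nonneg hΔ h2.nonempty hχ
  have hV := tiltedVariance_pos hΔ h2 hχ
  have hJ : 0 < ∫ t : ℝ, Real.exp (-(Δ.tiltedVariance χ / 2) * t ^ 2) := by
    rw [integral_gaussian]
    positivity
  -- The normalization involves none of P, k and a, so it cancels, together with J, in any quotient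
  -- of two such coefficients.
  refine ⟨fun n => √n * (2 * Real.pi) * r n ^ N n / Δ.eval (r n) ^ n,
    ∫ t : ℝ, Real.exp (-(Δ.tiltedVariance χ / 2) * t ^ 2), hJ, ?_, fun P k a => ?_⟩
  · filter_upwards [hrN, eventually_gt_atTop 0] with n hn hn0
    have := eval_pos_of_coeff_nonneg hΔ h2.nonempty hn.1
    have h3 := hn.1
    have : 0 < √(n : ℝ) := Real.sqrt_pos.2 (Nat.cast_pos.2 hn0)
    positivity
  -- a uniform lower bound for the atoms
  obtain ⟨p₀, hp₀, hp₀'⟩ : ∃ p₀ : ℝ, 0 < p₀ ∧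
      ∀ᶠ n in atTop, ∀ d ∈ Δ.support, p₀ ≤ Δ.tilt (r n) d := by
    obtain ⟨d₀, hd₀, hmin⟩ := Δ.support.exists_min_image (Δ.tilt χ) h2.nonempty
    have hpos := tilt_pos hΔ hχ hd₀
    refine ⟨Δ.tilt χ d₀ / 2, by linarith, (Finset.eventually_all _).2 fun d hd => ?_⟩
    have h3 : Δ.tilt χ d₀ / 2 < Δ.tilt χ d := by linarith [hmin d hd]
    exact ((tendsto_tilt hr hEχ.ne' d).eventually_const_lt h3).mono fun _ h => h.le
  obtain ⟨κ, hκ, hdecay⟩ := haper.exists_norm_le hp₀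
  -- a uniform bound for the perturbation
  obtain ⟨B, hB⟩ : ∃ B : ℝ, ∀ᶠ n in atTop, ∑ d ∈ P.support, |P.coeff d * r n ^ d| ≤ B := by
    have h3 : Tendsto (fun n => ∑ d ∈ P.support, |P.coeff d * r n ^ d|) atTop
        (𝓝 (∑ d ∈ P.support, |P.coeff d * χ ^ d|)) :=
      tendsto_finsetSum _ fun d _ => ((hr.pow d).const_mul _).abs
    exact ⟨_, (h3.eventually_lt_const (lt_add_one _)).mono fun _ h => h.le⟩
  have hmean : Tendsto (fun n => Δ.tiltedMean (r n)) atTop (𝓝 (Δ.tiltedMean χ)) :=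
    hN.congr' (hrN.mono fun n hn => hn.2.symm)
  have hint : Tendsto (fun n : ℕ => ∫ t : ℝ, (Set.Ioc (-(Real.pi * √n)) (Real.pi * √n)).indicator
      (cauchyIntegrand Δ P (r n) n (n - k) (N n - a)) t) atTop
      (𝓝 (∫ t : ℝ, ((P.eval χ * Real.exp (-(Δ.tiltedVariance χ) * t ^ 2 / 2) : ℝ) : ℂ))) := by
    refine MeasureTheory.tendsto_integral_filter_of_dominated_convergence
      (fun t => B * Real.exp (-(κ / 2) * t ^ 2)) ?_ ?_ ?_ ?_
    · exact Eventually.of_forall fun n => ((continuous_cauchyIntegrand _ _ _ _ _ _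
        ).aestronglyMeasurable).indicator measurableSet_Ioc
    · filter_upwards [hB, hp₀', hrN, eventually_gt_atTop 0, eventually_ge_atTop (2 * k)]
        with n hBn hpn hrn hn0 hnk
      refine Eventually.of_forall fun t => ?_
      have hs : 0 < √(n : ℝ) := Real.sqrt_pos.2 (Nat.cast_pos.2 hn0)
      have hB0 : 0 ≤ B := (Finset.sum_nonneg fun _ _ => abs_nonneg _).trans hBn
      by_cases ht : t ∈ Set.Ioc (-(Real.pi * √n)) (Real.pi * √n)
      · rw [Set.indicator_of_mem ht, cauchyIntegrand, norm_mul, norm_mul, norm_pow]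
        have e1 : ‖Complex.exp (-((N n - a : ℕ) * (t / √n : ℝ) * Complex.I))‖ = 1 := by
          have := Complex.norm_exp_ofReal_mul_I (-((N n - a : ℕ) * (t / √n)))
          push_cast at this ⊢
          rw [← neg_mul]
          exact this
        have habs : |t / √n| ≤ Real.pi := by
          rw [abs_div, abs_of_pos hs, div_le_iff₀ hs]
          exact abs_le.2 ⟨ht.1.le, ht.2⟩
        have hE := (eval_pos_of_coeff_nonneg hΔ h2.nonempty hrn.1).ne'
        have e2 := hdecay (Δ.tilt (r n)) (sum_tilt hE) hpn (t / √n) habs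
        rw [e1, mul_one]
        refine mul_le_mul ((norm_eval_map_mul_exp_le P _ _).trans hBn)
          ((pow_le_pow_left₀ (norm_nonneg _) e2 _).trans ?_) (by positivity) hB0
        rw [← Real.exp_nat_mul, Real.exp_le_exp, div_pow, Real.sq_sqrt (Nat.cast_nonneg n),
          Nat.cast_sub (by omega)]
        have hn0' : (0 : ℝ) < n := Nat.cast_pos.2 hn0
        have hnk' : (2 * k : ℝ) ≤ n := by exact_mod_cast hnk
        -- Only n - k ≥ n/2 factors are available for the decay, whence κ/2 in the dominating
        -- Gaussian.
        have e3 : (1 : ℝ) / 2 ≤ ((n : ℝ) - k) / n := by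
          rw [le_div_iff₀ hn0']; linarith
        have e4 : ((n : ℝ) - k) * -(κ * (t ^ 2 / n)) = -(κ * t ^ 2 * (((n : ℝ) - k) / n)) := by
          ring
        rw [e4]
        nlinarith [mul_le_mul_of_nonneg_left e3 (by positivity : 0 ≤ κ * t ^ 2)]
      · rw [Set.indicator_of_notMem ht, norm_zero]
        positivity
    · exact (integrable_exp_neg_mul_sq (by positivity)).const_mul B
    · refine Eventually.of_forall fun t => ?_
      refine (tendsto_cauchyIntegrand hr hEχ.ne' hmean (hrN.mono fun n hn => hn.2) hN'
        P k a t).congr' ?_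
      have hs : Tendsto (fun n : ℕ => Real.pi * √(n : ℝ)) atTop atTop :=
        (Real.tendsto_sqrt_atTop.comp tendsto_natCast_atTop_atTop).const_mul_atTop hpi
      filter_upwards [hs.eventually_gt_atTop |t|] with n hn
      rw [Set.indicator_of_mem]
      exact ⟨(abs_lt.1 hn).1, (abs_lt.1 hn).2.le⟩
  have hJ' : ∫ t : ℝ, ((P.eval χ * Real.exp (-(Δ.tiltedVariance χ) * t ^ 2 / 2) : ℝ) : ℂ) =
      ((P.eval χ * ∫ t : ℝ, Real.exp (-(Δ.tiltedVariance χ / 2) * t ^ 2) : ℝ) : ℂ) := by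
    rw [integral_complex_ofReal, MeasureTheory.integral_const_mul]
    congr 4
    ext t
    congr 1
    ring
  rw [hJ'] at hint
  have hreal := (Complex.continuous_re.tendsto _).comp hint
  have hfac : Tendsto (fun n => r n ^ a / Δ.eval (r n) ^ k) atTop (𝓝 (χ ^ a / Δ.eval χ ^ k)) :=
    (hr.pow a).div (((Δ.continuous.tendsto χ).comp hr).pow k) (pow_ne_zero _ hEχ.ne')
  have hprod := hreal.mul hfac
  rw [Complex.ofReal_re] at hprod
  have hrew : P.eval χ * (∫ t : ℝ, Real.exp (-(Δ.tiltedVariance χ / 2) * t ^ 2)) *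
      (χ ^ a / Δ.eval χ ^ k) = (∫ t : ℝ, Real.exp (-(Δ.tiltedVariance χ / 2) * t ^ 2)) *
      (P.eval χ * (χ ^ a / Δ.eval χ ^ k)) := by ring
  rw [hrew] at hprod
  refine hprod.congr' ?_
  filter_upwards [hrN, eventually_gt_atTop 0, eventually_ge_atTop k, hN'.eventually_ge_atTop a]
    with n hrn hn0 hnk hNa
  have hE := (eval_pos_of_coeff_nonneg hΔ h2.nonempty hrn.1).ne'
  simp only [Function.comp]
  rw [← coeff_mul_pow_eq_integral P hE hn0, Complex.ofReal_re]
  have e1 : r n ^ N n = r n ^ (N n - a) * r n ^ a := by rw [← pow_add, Nat.sub_add_cancel hNa]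
  have e2 : Δ.eval (r n) ^ n = Δ.eval (r n) ^ (n - k) * Δ.eval (r n) ^ k := by
    rw [← pow_add, Nat.sub_add_cancel hnk]
  rw [e1, e2]
  field_simp

end Polynomial

/-! ### The Leibniz rule as a sum over maps from half-edges to vertices. -/

namespace Polynomial

lemma eval_zero_iterate_derivative (P : Polynomial ℝ) (d : ℕ) :
    (derivative^[d] P).eval 0 = (d.factorial : ℝ) * P.coeff d := by
  rw [← coeff_zero_eq_eval_zero, coeff_iterate_derivative, zero_add, Nat.descFactorial_self,
    nsmul_eq_mul]

/-- The general Leibniz rule: a sum over all ways to let each of `N` derivations act on a factor. -/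
theorem iterate_derivative_prod {V : Type*} [Fintype V] [DecidableEq V] (N : ℕ)
    (P : V → Polynomial ℝ) :
    derivative^[N] (∏ v, P v) =
      ∑ w : Fin N → V, ∏ v, derivative^[∑ i, if w i = v then 1 else 0] (P v) := by
  induction N generalizing P with
  | zero => simp
  | succ N ih =>
    rw [Function.iterate_succ_apply, derivative_prod_finset, iterate_derivative_sum]
    rw [← (Fin.consEquiv fun _ => V).sum_comp, Fintype.sum_prod_type]
    refine Finset.sum_congr rfl fun u _ => ?_
    have h : (∏ a ∈ Finset.univ.erase u, P a) * derivative (P u) =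
        ∏ v, derivative^[if u = v then 1 else 0] (P v) := by
      rw [← Finset.prod_erase_mul _ _ (Finset.mem_univ u), if_pos rfl, Function.iterate_one]
      congr 1
      refine Finset.prod_congr rfl fun v hv => ?_
      rw [if_neg (Finset.ne_of_mem_erase hv).symm, Function.iterate_zero, id]
    rw [h, ih]
    refine Finset.sum_congr rfl fun w _ => Finset.prod_congr rfl fun v _ => ?_
    rw [← Function.iterate_add_apply, Fin.sum_univ_succ, add_comm]
    simp [Fin.consEquiv]

theorem iterate_derivative_prod_card {V A : Type*} [Fintype V] [DecidableEq V] [Fintype A]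
    [DecidableEq A] (P : V → Polynomial ℝ) :
    derivative^[Fintype.card A] (∏ v, P v) =
      ∑ w : A → V, ∏ v, derivative^[∑ a, if w a = v then 1 else 0] (P v) := by
  rw [iterate_derivative_prod, ← ((Fintype.equivFin A).symm.arrowCongr (Equiv.refl V)).sum_comp]
  refine Finset.sum_congr rfl fun w _ => Finset.prod_congr rfl fun v _ => ?_
  congr 1
  rw [← (Fintype.equivFin A).sum_comp]
  rfl

/-- Sums over functions with prescribed values along an injection. -/
theorem sum_prod_derivative_of_prescribed {V A B : Type*} [Fintype V] [DecidableEq V] [Fintype A]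
    [DecidableEq A] [Fintype B] [DecidableEq B] (Δ : Polynomial ℝ) (j : B ↪ A) (u : B → V) :
    (∑ t : A → V, if t ∘ j = u then
      ∏ v, (derivative^[∑ a, if t a = v then 1 else 0] Δ) else 0) =
      derivative^[Fintype.card A - Fintype.card B]
        (∏ v, derivative^[∑ b, if u b = v then 1 else 0] Δ) := by
  classical
  -- Split A into prescribed and free elements. On the prescribed part only u contributes; the free
  -- part carries the remaining derivations.
  let e : B ⊕ (↥(Set.range j)ᶜ) ≃ A :=
    (Equiv.sumCongr (Equiv.ofInjective j j.injective) (Equiv.refl _)).trans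
      (Equiv.Set.sumCompl (Set.range j))
  have he : ∀ b, e (Sum.inl b) = j b := fun b => rfl
  have hcard : Fintype.card A - Fintype.card B = Fintype.card (↥(Set.range j)ᶜ) := by
    rw [← Fintype.card_congr e, Fintype.card_sum]
    omega
  rw [hcard, iterate_derivative_prod_card,
    ← ((Equiv.sumArrowEquivProdArrow _ _ V).symm.trans (e.arrowCongr (Equiv.refl V))).sum_comp,
    Fintype.sum_prod_type, Finset.sum_eq_single u]
  · refine Finset.sum_congr rfl fun w _ => ?_
    rw [if_pos]
    · refine Finset.prod_congr rfl fun v _ => ?_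
      rw [← Function.iterate_add_apply]
      congr 1
      rw [← e.sum_comp, Fintype.sum_sum_type, add_comm]
      simp [Equiv.arrowCongr]
    · ext b
      simp [Equiv.arrowCongr, ← he]
  · intro u' _ hu'
    refine Finset.sum_eq_zero fun w _ => ?_
    rw [if_neg]
    intro h
    apply hu'
    ext b
    have := congrFun h b
    simpa [Equiv.arrowCongr, ← he] using this
  · simp

end Polynomial

/-! ### Half-edges, embeddings and the exact first moment. -/

namespace Multigraph

variable {V E V₁ E₁ : Type}

/-- The vertex to which a half-edge is attached; the half-edge `(e, false)` is the start of the edge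
`e` and `(e, true)` is its end. -/
def tip (G : Multigraph V E) (h : E × Bool) : V := bif h.2 then (G.ends h.1).2 else (G.ends h.1).1

@[simp] lemma tip_true (G : Multigraph V E) (e : E) : G.tip (e, true) = (G.ends e).2 := rfl
@[simp] lemma tip_false (G : Multigraph V E) (e : E) : G.tip (e, false) = (G.ends e).1 := rfl

/-- Multigraphs as functions on half-edges. -/
def tipEquiv (V E : Type) : Multigraph V E ≃ (E × Bool → V) where
  toFun := tip
  invFun t := ⟨fun e => (t (e, false), t (e, true))⟩
  left_inv _ := rfl
  right_inv t := by ext ⟨e, b⟩; cases b <;> rfl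

lemma degree_eq_card_tip [Finite E] (G : Multigraph V E) (v : V) :
    G.degree v = Nat.card {h : E × Bool // G.tip h = v} := by
  rw [degree, ← Nat.card_sum]
  refine Nat.card_congr
    { toFun := Sum.elim (fun e => ⟨(e, false), e.2⟩) (fun e => ⟨(e, true), e.2⟩)
      invFun := fun h => match h with
        | ⟨(e, false), h⟩ => Sum.inl ⟨e, h⟩
        | ⟨(e, true), h⟩ => Sum.inr ⟨e, h⟩
      left_inv := by rintro (e | e) <;> rfl
      right_inv := by rintro ⟨⟨e, _ | _⟩, h⟩ <;> rfl }

lemma degree_eq_sum [Fintype E] [DecidableEq V] (G : Multigraph V E) (v : V) :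
    G.degree v = ∑ h : E × Bool, if G.tip h = v then 1 else 0 := by
  rw [degree_eq_card_tip, Nat.card_eq_fintype_card, Fintype.card_subtype, Finset.card_filter]

lemma sum_degree [Fintype V] [Fintype E] (G : Multigraph V E) :
    ∑ v, G.degree v = 2 * Fintype.card E := by
  classical
  simp_rw [degree_eq_sum]
  rw [Finset.sum_comm]
  simp [mul_comm]

/-- The number d! [x^d]Δ is Δ^(d)(0); in this form the weight is a single term of the Leibniz
expansion. -/
lemma weight_eq [Fintype V] (Δ : Polynomial ℝ) (G : Multigraph V E) :
    weight Δ G = ∏ v, (Polynomial.derivative^[G.degree v] Δ).eval 0 := by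
  simp_rw [Polynomial.eval_zero_iterate_derivative]
  rfl

/-- An embedding of multigraphs that keeps track of half-edges: injections of the vertices and of
the edges, and for each edge whether its orientation is reversed. -/
@[ext]
structure Emb (H : Multigraph V E) (G : Multigraph V₁ E₁) where
  vert : V ↪ V₁
  edge : E ↪ E₁
  flip : E → Bool
  tip_edge : ∀ e b, G.tip (edge e, xor (flip e) b) = vert (H.tip (e, b))

/-- An embedding amounts to two injections and a set of reversed edges, subject to a condition. -/
def Emb.equivSubtype (H : Multigraph V E) (G : Multigraph V₁ E₁) :
    Emb H G ≃ {x : (V ↪ V₁) × (E ↪ E₁) × (E → Bool) //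
      ∀ e b, G.tip (x.2.1 e, xor (x.2.2 e) b) = x.1 (H.tip (e, b))} where
  toFun x := ⟨(x.vert, x.edge, x.flip), x.tip_edge⟩
  invFun x := ⟨x.1.1, x.1.2.1, x.1.2.2, x.2⟩
  left_inv _ := rfl
  right_inv _ := rfl

instance [Finite V] [Finite E] [Finite V₁] [Finite E₁] (H : Multigraph V E)
    (G : Multigraph V₁ E₁) : Finite (Emb H G) :=
  Finite.of_equiv _ (Emb.equivSubtype H G).symm

/-- The injection of half-edges given by an injection of edges and a set of reversed edges. -/
def halfEdgeEmb (ψ : E ↪ E₁) (o : E → Bool) : E × Bool ↪ E₁ × Bool where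
  toFun h := (ψ h.1, xor (o h.1) h.2)
  inj' := by
    rintro ⟨e, b⟩ ⟨e', b'⟩ h
    obtain ⟨h1, h2⟩ := Prod.ext_iff.1 h
    obtain rfl : e = e' := ψ.injective h1
    simpa using h2

/-- A vertex outside the image of φ receives no half-edge of H and contributes an undifferentiated
Δ. -/
lemma prod_extend [Fintype V] [Fintype V₁] [DecidableEq V₁] [Fintype E] (H : Multigraph V E)
    (φ : V ↪ V₁) (Δ : Polynomial ℝ) :
    ∏ v, Polynomial.derivative^[∑ h : E × Bool, if φ (H.tip h) = v then 1 else 0] Δ =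
      (∏ u, Polynomial.derivative^[H.degree u] Δ) *
        Δ ^ (Fintype.card V₁ - Fintype.card V) := by
  classical
  rw [← Finset.prod_mul_prod_compl (Finset.univ.map φ), Finset.prod_map]
  congr 1
  · refine Finset.prod_congr rfl fun u _ => ?_
    simp_rw [degree_eq_sum, φ.injective.eq_iff]
  · rw [Finset.prod_eq_pow_card (b := Δ), Finset.card_compl, Finset.card_map, Finset.card_univ]
    intro v hv
    rw [Finset.sum_eq_zero, Function.iterate_zero, id]
    intro h _
    rw [if_neg]
    rintro rfl
    simp at hv

/-- The Leibniz rule for Δ^n read backwards: each derivation is a half-edge, and the factor on which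
it acts is the vertex that it meets. -/
theorem totalWeight_eq (Δ : Polynomial ℝ) (n m : ℕ) :
    totalWeight Δ n m = (Polynomial.derivative^[2 * m] (Δ ^ n)).eval 0 := by
  have h := Polynomial.iterate_derivative_prod_card (A := Fin m × Bool) (fun _ : Fin n => Δ)
  rw [Fintype.card_prod, Fintype.card_bool, Fintype.card_fin, mul_comm, Finset.prod_const,
    Finset.card_univ, Fintype.card_fin] at h
  rw [h, Polynomial.eval_finsetSum, totalWeight, ← (tipEquiv (Fin n) (Fin m)).sum_comp]
  refine Finset.sum_congr rfl fun G _ => ?_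
  rw [weight_eq, Polynomial.eval_prod]
  refine Finset.prod_congr rfl fun v _ => ?_
  rw [degree_eq_sum]
  rfl

/-- The exact first moment of the number of embeddings of `H`, up to normalization. -/
theorem sum_weight_mul_card_emb (Δ : Polynomial ℝ) (n m : ℕ) [Fintype V] [Fintype E]
    (H : Multigraph V E) :
    ∑ G : Multigraph (Fin n) (Fin m), weight Δ G * (Nat.card (Emb H G) : ℝ) =
      (n.descFactorial (Fintype.card V) * (m.descFactorial (Fintype.card E) *
        2 ^ Fintype.card E) : ℝ) *
      (Polynomial.derivative^[2 * m - 2 * Fintype.card E]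
        ((∏ u, Polynomial.derivative^[H.degree u] Δ) * Δ ^ (n - Fintype.card V))).eval 0 := by
  classical
  have h1 : ∀ G : Multigraph (Fin n) (Fin m), weight Δ G * (Nat.card (Emb H G) : ℝ) =
      ∑ x : (V ↪ Fin n) × (E ↪ Fin m) × (E → Bool),
        if G.tip ∘ halfEdgeEmb x.2.1 x.2.2 = x.1 ∘ H.tip then weight Δ G else 0 := by
    intro G
    rw [Nat.card_congr (Emb.equivSubtype H G), Nat.card_eq_fintype_card, Fintype.card_subtype,
      ← Finset.sum_filter, Finset.sum_const, nsmul_eq_mul, mul_comm]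
    congr 3
    ext x
    simp only [Finset.mem_filter, Finset.mem_univ, true_and, funext_iff, Prod.forall]
    rfl
  simp_rw [h1]
  rw [Finset.sum_comm]
  -- The sum over G does not depend on the placement x of H, so the number of placements factors
  -- out.
  have h2 : ∀ x : (V ↪ Fin n) × (E ↪ Fin m) × (E → Bool),
      (∑ G : Multigraph (Fin n) (Fin m),
        if G.tip ∘ halfEdgeEmb x.2.1 x.2.2 = x.1 ∘ H.tip then weight Δ G else 0) =
      (Polynomial.derivative^[2 * m - 2 * Fintype.card E]
        ((∏ u, Polynomial.derivative^[H.degree u] Δ) * Δ ^ (n - Fintype.card V))).eval 0 := by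
    intro x
    have h3 := Polynomial.sum_prod_derivative_of_prescribed Δ (halfEdgeEmb x.2.1 x.2.2)
      (x.1 ∘ H.tip)
    have h4 := prod_extend H x.1 Δ
    simp only [Function.comp_apply] at h3
    rw [h4] at h3
    simp only [Fintype.card_prod, Fintype.card_fin, Fintype.card_bool, mul_comm _ 2] at h3
    rw [← h3, Polynomial.eval_finsetSum, ← (tipEquiv (Fin n) (Fin m)).sum_comp]
    refine Finset.sum_congr rfl fun G _ => ?_
    rw [apply_ite (Polynomial.eval 0), Polynomial.eval_zero, Polynomial.eval_prod, weight_eq]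
    simp_rw [degree_eq_sum]
    rfl
  rw [Finset.sum_congr rfl fun x _ => h2 x, Finset.sum_const, nsmul_eq_mul, Finset.card_univ]
  simp only [Fintype.card_prod, Fintype.card_embedding_eq, Fintype.card_fin, Fintype.card_fun,
    Fintype.card_bool]
  push_cast
  rfl

/-! ### Asymptotics of the first moment. -/

lemma tendsto_descFactorial_div_pow (a : ℕ) {N : ℕ → ℕ} (hN : Tendsto N atTop atTop) :
    Tendsto (fun n => ((N n).descFactorial a : ℝ) / (N n : ℝ) ^ a) atTop (𝓝 1) := by
  induction a with
  | zero => simp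
  | succ a ih =>
    have hN' : Tendsto (fun n => (N n : ℝ)) atTop atTop := tendsto_natCast_atTop_atTop.comp hN
    have h1 : Tendsto (fun n => 1 - (a : ℝ) / N n) atTop (𝓝 (1 - 0)) :=
      tendsto_const_nhds.sub (tendsto_const_nhds.div_atTop hN')
    have h2 := h1.mul ih
    rw [sub_zero, one_mul] at h2
    refine h2.congr' ?_
    filter_upwards [hN.eventually_ge_atTop a, hN.eventually_gt_atTop 0] with n hn hn0
    have : (0 : ℝ) < N n := Nat.cast_pos.2 hn0
    rw [Nat.descFactorial_succ, Nat.cast_mul, Nat.cast_sub hn, pow_succ]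
    field_simp

/-- The limit in the first moment asymptotics: the product over the vertices of `H` of
`χ ^ d Δ^(d)(χ) / Δ(χ)`, with `d` the degree of the vertex. -/
noncomputable def vertexFactor [Fintype V] (Δ : Polynomial ℝ) (χ : ℝ) (H : Multigraph V E) : ℝ :=
  ∏ v : V, χ ^ H.degree v * (Polynomial.derivative^[H.degree v] Δ).eval χ / Δ.eval χ

lemma vertexFactor_eq [Fintype V] [Fintype E] (Δ : Polynomial ℝ) (χ : ℝ) (H : Multigraph V E) :
    vertexFactor Δ χ H = (∏ u, Polynomial.derivative^[H.degree u] Δ).eval χ *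
      (χ ^ (2 * Fintype.card E) / Δ.eval χ ^ Fintype.card V) := by
  rw [vertexFactor, Finset.prod_div_distrib, Finset.prod_mul_distrib, Finset.prod_pow_eq_pow_sum,
    sum_degree, Polynomial.eval_prod, Finset.prod_const, Finset.card_univ]
  ring

section Asymptotics

variable {Δ : Polynomial ℝ} {χ : ℝ} {m : ℕ → ℕ}

/-- For large `n` the random multigraph is well defined, and the expected number of embeddings of
`H` is asymptotically a multiple of `n ^ |V(H)| / (2 m) ^ |E(H)|`. -/
theorem tendsto_expect_card_emb (hΔ : ∀ d, 0 ≤ Δ.coeff d) (haper : Δ.IsAperiodic)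
    (h2 : Δ.support.Nontrivial) (hχ : 0 < χ)
    (hm : Tendsto (fun n : ℕ => 2 * (m n : ℝ) / n) atTop (𝓝 (Δ.tiltedMean χ)))
    (hm' : Tendsto m atTop atTop) :
    (∀ᶠ n : ℕ in atTop, 0 < totalWeight Δ n (m n)) ∧
    ∀ (V E : Type) [Fintype V] [Fintype E] (H : Multigraph V E),
      Tendsto (fun n : ℕ => expect Δ n (m n) (fun G => (Nat.card (Emb H G) : ℝ)) /
        ((n : ℝ) ^ Fintype.card V / (2 * (m n : ℝ)) ^ Fintype.card E)) atTop
        (𝓝 (vertexFactor Δ χ H)) := by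
  have hN : Tendsto (fun n => ((2 * m n : ℕ) : ℝ) / n) atTop (𝓝 (Δ.tiltedMean χ)) := by
    simpa using hm
  have hN' : Tendsto (fun n => 2 * m n) atTop atTop := hm'.const_mul_atTop' two_pos
  obtain ⟨s, J, hJ, hs, hlim⟩ := Polynomial.tendsto_scaled_coeff hΔ haper h2 hχ hN hN'
  have hT : Tendsto (fun n => s n * (Δ ^ n).coeff (2 * m n)) atTop (𝓝 J) := by
    simpa using hlim 1 0 0
  refine ⟨?_, fun V E _ _ H => ?_⟩
  · filter_upwards [hs, hT.eventually_const_lt hJ] with n hn hn'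
    rw [totalWeight_eq, Polynomial.eval_zero_iterate_derivative]
    have := pos_of_mul_pos_right hn' hn.le
    positivity
  set k := Fintype.card V
  set q := Fintype.card E
  set P := ∏ u, Polynomial.derivative^[H.degree u] Δ with hP
  have hA := (hlim P k (2 * q)).div hT hJ.ne'
  -- The number of placements and the factorials from the derivatives combine to (n)_k (m)_q 2^q /
  -- (2m)_(2q), with falling factorials, which is asymptotic to n^k/(2m)^q.
  have hB := tendsto_descFactorial_div_pow k tendsto_id
  have hC := tendsto_descFactorial_div_pow q hm'
  have hD := (tendsto_descFactorial_div_pow (2 * q) hN').inv₀ one_ne_zero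
  have hall := ((hB.mul hC).mul hD).mul hA
  have hval : 1 * 1 * 1⁻¹ * (J * (P.eval χ * (χ ^ (2 * q) / Δ.eval χ ^ k)) / J) =
      vertexFactor Δ χ H := by
    rw [vertexFactor_eq, one_mul, one_mul, inv_one, one_mul, mul_div_cancel_left₀ _ hJ.ne']
  rw [hval] at hall
  refine hall.congr' ?_
  filter_upwards [hs, hT.eventually_const_lt hJ, eventually_gt_atTop 0,
    hm'.eventually_ge_atTop q, hm'.eventually_gt_atTop 0] with n hsn hTn hn0 hq hm0
  have hcoef : 0 < (Δ ^ n).coeff (2 * m n) := pos_of_mul_pos_right hTn hsn.le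
  have hexp : expect Δ n (m n) (fun G => (Nat.card (Emb H G) : ℝ)) =
      (∑ G : Multigraph (Fin n) (Fin (m n)), weight Δ G * (Nat.card (Emb H G) : ℝ)) /
        totalWeight Δ n (m n) := by
    rw [expect, Finset.sum_div]
    exact Finset.sum_congr rfl fun G _ => by ring
  rw [hexp, sum_weight_mul_card_emb, totalWeight_eq, Polynomial.eval_zero_iterate_derivative,
    Polynomial.eval_zero_iterate_derivative]
  have hfac : ((2 * m n).factorial : ℝ) =
      ((2 * m n - 2 * q).factorial : ℝ) * ((2 * m n).descFactorial (2 * q) : ℝ) := by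
    exact_mod_cast (Nat.factorial_mul_descFactorial (by omega : 2 * q ≤ 2 * m n)).symm
  have hd : ((2 * m n).descFactorial (2 * q) : ℝ) ≠ 0 := by
    have : 0 < (2 * m n).descFactorial (2 * q) := Nat.descFactorial_pos.2 (by omega)
    positivity
  have hn0' : (n : ℝ) ≠ 0 := by positivity
  have hm0' : (m n : ℝ) ≠ 0 := by positivity
  rw [hfac]
  simp only [Pi.div_apply, id]
  push_cast
  field_simp
  ring

end Asymptotics

end Multigraph

/-! ### Embeddings versus subgraphs and automorphisms. -/

namespace Multigraph

variable {V E V₁ E₁ V₂ E₂ : Type}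

/-- The inverse of an isomorphism. -/
def Iso.symm {G : Multigraph V E} {H : Multigraph V₁ E₁} (i : Iso G H) : Iso H G where
  vert := i.vert.symm
  edge := i.edge.symm
  map_ends e := by
    have h := congrArg (Sym2.map i.vert.symm) (i.map_ends (i.edge.symm e))
    simpa using h.symm

/-- Unordered pairs of endpoints agree when ordered pairs agree up to a reversal; this translates
`Iso` into `Emb`. At a loop both values of o work. -/
lemma sym2_ends_eq_iff (G : Multigraph V₁ E₁) (H : Multigraph V E) (f : V → V₁) (e' : E₁) (e : E) :
    s((G.ends e').1, (G.ends e').2) = s(f (H.ends e).1, f (H.ends e).2) ↔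
      ∃ o : Bool, ∀ b, G.tip (e', xor o b) = f (H.tip (e, b)) := by
  rw [Sym2.eq_iff]
  constructor
  · rintro (⟨h1, h2⟩ | ⟨h1, h2⟩)
    · exact ⟨false, by rintro (_ | _) <;> simp [h1, h2]⟩
    · exact ⟨true, by rintro (_ | _) <;> simp [h1, h2]⟩
  · rintro ⟨_ | _, h⟩
    · exact Or.inl ⟨h false, h true⟩
    · exact Or.inr ⟨h true, h false⟩

@[ext]
lemma Sub.ext_sets {G : Multigraph V E} {S T : G.Sub} (h1 : S.verts = T.verts)
    (h2 : S.edges = T.edges) : S = T := by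
  cases S; cases T; cases h1; cases h2; rfl

lemma Sub.tip_mem {G : Multigraph V E} (S : G.Sub) {e : E} (he : e ∈ S.edges) (b : Bool) :
    G.tip (e, b) ∈ S.verts := by
  cases b
  · exact (S.closed e he).1
  · exact (S.closed e he).2

lemma Sub.coe_tip_toMultigraph {G : Multigraph V E} (S : G.Sub) (e : S.edges) (b : Bool) :
    (S.toMultigraph.tip (e, b) : V) = G.tip (e.1, b) := by
  cases b <;> rfl

instance [Finite V] [Finite E] (G : Multigraph V E) : Finite G.Sub :=
  Finite.of_injective (fun S : G.Sub => (S.verts, S.edges)) fun _ _ h =>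
    Sub.ext_sets (Prod.ext_iff.1 h).1 (Prod.ext_iff.1 h).2

namespace Emb

variable {H : Multigraph V E} {G : Multigraph V₁ E₁}

lemma tip_edge' (x : Emb H G) (e : E) (b : Bool) :
    G.tip (x.edge e, b) = x.vert (H.tip (e, xor (x.flip e) b)) := by
  rw [← x.tip_edge, ← Bool.xor_assoc, Bool.xor_self, Bool.false_xor]

/-- The subgraph covered by an embedding. -/
def image (x : Emb H G) : G.Sub where
  verts := Set.range x.vert
  edges := Set.range x.edge
  closed := by
    rintro _ ⟨e, rfl⟩
    exact ⟨⟨_, (x.tip_edge' e false).symm⟩, ⟨_, (x.tip_edge' e true).symm⟩⟩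

/-- Composition of embeddings. -/
def comp {K : Multigraph V₂ E₂} (x : Emb H G) (a : Emb K H) : Emb K G where
  vert := a.vert.trans x.vert
  edge := a.edge.trans x.edge
  flip e := xor (a.flip e) (x.flip (a.edge e))
  tip_edge e b := by
    simp only [Function.Embedding.trans_apply]
    rw [← a.tip_edge, ← x.tip_edge, ← Bool.xor_assoc, Bool.xor_comm (x.flip _)]

lemma comp_injective {K : Multigraph V₂ E₂} (x : Emb H G) :
    Function.Injective (x.comp : Emb K H → Emb K G) := by
  intro a a' h
  have hv : a.vert = a'.vert := by
    ext v
    exact x.vert.injective (DFunLike.congr_fun (congrArg Emb.vert h) v)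
  have he : a.edge = a'.edge := by
    ext e
    exact x.edge.injective (DFunLike.congr_fun (congrArg Emb.edge h) e)
  refine Emb.ext hv he ?_
  funext e
  have := congrFun (congrArg Emb.flip h) e
  simpa [comp, he] using this

lemma image_comp [Finite V] [Finite E] (x : Emb H G) (a : Emb H H) :
    (x.comp a).image = x.image := by
  refine Sub.ext_sets ?_ ?_
  · exact (Finite.surjective_of_injective a.vert.injective).range_comp x.vert
  · exact (Finite.surjective_of_injective a.edge.injective).range_comp x.edge

/-- Equal ranges let y factor through the injections of x; the reversals of the factor are the
differences of those of y and x. -/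
lemma exists_comp_eq (x y : Emb H G) (h : y.image = x.image) : ∃ a : Emb H H, x.comp a = y := by
  have hv : ∀ v, ∃ u, x.vert u = y.vert v := fun v => by
    have : y.vert v ∈ x.image.verts := by rw [← h]; exact ⟨v, rfl⟩
    exact this
  have he : ∀ e, ∃ f, x.edge f = y.edge e := fun e => by
    have : y.edge e ∈ x.image.edges := by rw [← h]; exact ⟨e, rfl⟩
    exact this
  choose av hav using hv
  choose ae hae using he
  refine ⟨⟨⟨av, fun u v huv => ?_⟩, ⟨ae, fun u v huv => ?_⟩,
    fun e => xor (y.flip e) (x.flip (ae e)), fun e b => ?_⟩, ?_⟩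
  · exact y.vert.injective (by rw [← hav, ← hav, huv])
  · exact y.edge.injective (by rw [← hae, ← hae, huv])
  · apply x.vert.injective
    change x.vert (H.tip (ae e, _)) = x.vert (av _)
    rw [hav, ← y.tip_edge, ← hae, x.tip_edge']
    congr 3
    cases y.flip e <;> cases x.flip (ae e) <;> cases b <;> rfl
  · refine Emb.ext ?_ ?_ ?_
    · ext v; exact hav v
    · ext e; exact hae e
    · funext e
      change xor (xor (y.flip e) (x.flip (ae e))) (x.flip (ae e)) = y.flip e
      rw [Bool.xor_assoc, Bool.xor_self, Bool.xor_false]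

end Emb

lemma nonempty_iso_iff {G : Multigraph V₁ E₁} (S : G.Sub) (H : Multigraph V E) :
    Nonempty (Iso S.toMultigraph H) ↔ ∃ x : Emb H G, x.image = S := by
  constructor
  · rintro ⟨i⟩
    have h : ∀ e, ∃ o : Bool, ∀ b,
        S.toMultigraph.tip (i.symm.edge e, xor o b) = i.symm.vert (H.tip (e, b)) := fun e =>
      (sym2_ends_eq_iff _ _ _ _ _).1 (i.symm.map_ends e)
    choose o ho using h
    refine ⟨⟨i.symm.vert.toEmbedding.trans (Function.Embedding.subtype _),
      i.symm.edge.toEmbedding.trans (Function.Embedding.subtype _), o, fun e b => ?_⟩, ?_⟩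
    · have := congrArg Subtype.val (ho e b)
      rw [Sub.coe_tip_toMultigraph] at this
      exact this
    · refine Sub.ext_sets ?_ ?_
      · change Set.range (Subtype.val ∘ i.symm.vert) = _
        rw [i.symm.vert.surjective.range_comp, Subtype.range_coe]
      · change Set.range (Subtype.val ∘ i.symm.edge) = _
        rw [i.symm.edge.surjective.range_comp, Subtype.range_coe]
  · rintro ⟨x, rfl⟩
    refine ⟨Iso.symm ⟨Equiv.ofInjective _ x.vert.injective, Equiv.ofInjective _ x.edge.injective,
      fun e => ?_⟩⟩
    refine (sym2_ends_eq_iff _ _ _ _ _).2 ⟨x.flip e, fun b => Subtype.ext ?_⟩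
    rw [Sub.coe_tip_toMultigraph]
    exact x.tip_edge e b

/-- An embedding is determined by its image and a self-embedding. -/
theorem exists_embEquiv [Finite V] [Finite E] (H : Multigraph V E) (G : Multigraph V₁ E₁) :
    ∃ f : Emb H G ≃ {S : G.Sub // Nonempty (Iso S.toMultigraph H)} × Emb H H,
      ∀ x, ((f x).1 : G.Sub) = x.image := by
  choose rep hrep using fun S : {S : G.Sub // Nonempty (Iso S.toMultigraph H)} =>
    (nonempty_iso_iff S.1 H).1 S.2
  let g : {S : G.Sub // Nonempty (Iso S.toMultigraph H)} × Emb H H → Emb H G :=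
    fun p => (rep p.1).comp p.2
  have himg : ∀ p, (g p).image = p.1 := fun p => by rw [Emb.image_comp, hrep]
  have hg : Function.Bijective g := by
    constructor
    · rintro ⟨S, a⟩ ⟨S', a'⟩ h
      obtain rfl : S = S' := Subtype.ext (by
        have := congrArg Emb.image h
        rwa [himg, himg] at this)
      exact congrArg (Prod.mk S) ((rep S).comp_injective h)
    · intro y
      have hy : Nonempty (Iso y.image.toMultigraph H) := (nonempty_iso_iff _ _).2 ⟨y, rfl⟩
      obtain ⟨a, ha⟩ := Emb.exists_comp_eq (rep ⟨y.image, hy⟩) y (hrep ⟨y.image, hy⟩).symm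
      exact ⟨(⟨y.image, hy⟩, a), ha⟩
  refine ⟨(Equiv.ofBijective g hg).symm, fun x => ?_⟩
  rw [← himg, ← Equiv.ofBijective_apply g hg, Equiv.apply_symm_apply]

/-- Self-embeddings of H act freely and transitively on the embeddings with a given image. -/
theorem card_emb [Finite V] [Finite E] (H : Multigraph V E) (G : Multigraph V₁ E₁) :
    Nat.card (Emb H G) = G.count H * Nat.card (Emb H H) := by
  obtain ⟨f, -⟩ := exists_embEquiv H G
  rw [Nat.card_congr f, Nat.card_prod]
  rfl

/-- The identity embedding. -/
def Emb.refl (H : Multigraph V E) : Emb H H where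
  vert := Function.Embedding.refl V
  edge := Function.Embedding.refl E
  flip _ := false
  tip_edge e b := by simp

lemma card_emb_self_pos [Finite V] [Finite E] (H : Multigraph V E) : 0 < Nat.card (Emb H H) :=
  have : Nonempty (Emb H H) := ⟨Emb.refl H⟩
  Nat.card_pos

/-- Without loops, self-embeddings are the same as automorphisms. -/
theorem card_emb_self_eq_aut [Finite V] [Finite E] (H : Multigraph V E)
    (hH : ∀ e, (H.ends e).1 ≠ (H.ends e).2) : Nat.card (Emb H H) = H.aut := by
  let f : Emb H H → Iso H H := fun x =>
    ⟨Equiv.ofBijective x.vert (Finite.injective_iff_bijective.1 x.vert.injective),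
      Equiv.ofBijective x.edge (Finite.injective_iff_bijective.1 x.edge.injective),
      fun e => (sym2_ends_eq_iff _ _ _ _ _).2 ⟨x.flip e, x.tip_edge e⟩⟩
  refine Nat.card_eq_of_bijective f ⟨fun x y h => ?_, fun i => ?_⟩
  · have hv : x.vert = y.vert := by
      ext v
      exact DFunLike.congr_fun (congrArg Iso.vert h) v
    have he : x.edge = y.edge := by
      ext e
      exact DFunLike.congr_fun (congrArg Iso.edge h) e
    refine Emb.ext hv he (funext fun e => ?_)
    -- Two different reversals of the same edge would put both of its ends at one vertex, making it
    -- a loop.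
    have h1 := x.tip_edge e false
    rw [hv, he, ← y.tip_edge e false] at h1
    have h2 := hH (y.edge e)
    rcases hx : x.flip e with _ | _ <;> rcases hy : y.flip e with _ | _ <;> rw [hx, hy] at h1
    · exact absurd h1 h2
    · exact absurd h1.symm h2
  · choose o ho using fun e => (sym2_ends_eq_iff _ _ _ _ _).1 (i.map_ends e)
    refine ⟨⟨i.vert.toEmbedding, i.edge.toEmbedding, o, ho⟩, ?_⟩
    cases i
    simp only [f, Iso.mk.injEq]
    constructor
    · ext; rfl
    · ext; rfl

lemma Sub.isCycle_iff {G : Multigraph V E} (S : G.Sub) :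
    S.IsCycle ↔ ∃ ℓ, 1 ≤ ℓ ∧ ∃ x : Emb (cycle ℓ) G, x.image = S := by
  simp only [IsCycle, nonempty_iso_iff]

end Multigraph

/-! ### Trees and unicycles characterized by counting edges and vertices. -/

namespace Multigraph

variable {V E V₁ E₁ : Type}

/-- The simple graph underlying a multigraph. -/
def underlying (G : Multigraph V E) : SimpleGraph V :=
  SimpleGraph.fromRel fun u v : V => ∃ e : E, G.ends e = (u, v)

lemma underlying_adj_iff (G : Multigraph V E) (u v : V) :
    G.underlying.Adj u v ↔ u ≠ v ∧ ∃ e, s((G.ends e).1, (G.ends e).2) = s(u, v) := by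
  rw [underlying, SimpleGraph.fromRel_adj, ← exists_or]
  refine and_congr_right fun _ => exists_congr fun e => ?_
  rw [Sym2.eq_iff, Prod.ext_iff, Prod.ext_iff]

lemma reachable_tip (G : Multigraph V E) (e : E) (b b' : Bool) :
    G.underlying.Reachable (G.tip (e, b)) (G.tip (e, b')) := by
  have h : G.underlying.Reachable (G.ends e).1 (G.ends e).2 := by
    by_cases h : (G.ends e).1 = (G.ends e).2
    · rw [h]
    · exact ((G.underlying_adj_iff _ _).2 ⟨h, e, rfl⟩).reachable
  cases b <;> cases b'
  · rfl
  · exact h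
  · exact h.symm
  · rfl

lemma Connected.of_reachable_ends {G : Multigraph V E} {G' : Multigraph V E₁} (hG : G.Connected)
    (h : ∀ e, G'.underlying.Reachable (G.ends e).1 (G.ends e).2) : G'.Connected := by
  have hne := hG.nonempty
  refine (SimpleGraph.connected_iff _).2 ⟨fun u v => ?_, hne⟩
  have huv := (SimpleGraph.reachable_iff_reflTransGen u v).1 (hG.preconnected u v)
  induction huv with
  | refl => rfl
  | tail _ hadj ih =>
    obtain ⟨-, e, he⟩ := (G.underlying_adj_iff _ _).1 hadj
    refine ih.trans ?_
    rcases Sym2.eq_iff.1 he with ⟨h1, h2⟩ | ⟨h1, h2⟩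
    · rw [← h1, ← h2]; exact h e
    · rw [← h1, ← h2]; exact (h e).symm

/-- Removal of an edge. -/
def erase (G : Multigraph V E) (e₀ : E) : Multigraph V {e // e ≠ e₀} where
  ends e := G.ends e

lemma cycle_tip_true {ℓ : ℕ} (i : Fin (ℓ + 1)) : (cycle (ℓ + 1)).tip (i, true) = i + 1 := by
  rw [tip_true]
  exact finRotate_apply i

lemma cycle_tip_false {ℓ : ℕ} (i : Fin ℓ) : (cycle ℓ).tip (i, false) = i := rfl

open scoped Fin.CommRing in
/-- Removal of an edge of a cycle does not disconnect. -/
lemma Connected.erase_cycle {G : Multigraph V E} (hG : G.Connected) {ℓ : ℕ}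
    (x : Emb (cycle (ℓ + 1)) G) (j : Fin (ℓ + 1)) : (G.erase (x.edge j)).Connected := by
  set G' := G.erase (x.edge j)
  have hstep : ∀ i : Fin (ℓ + 1), i ≠ j → G'.underlying.Reachable (x.vert i) (x.vert (i + 1)) := by
    intro i hij
    have hne : x.edge i ≠ x.edge j := fun h => hij (x.edge.injective h)
    have h := G'.reachable_tip ⟨x.edge i, hne⟩ (xor (x.flip i) false) (xor (x.flip i) true)
    have h1 : ∀ b, G'.tip (⟨x.edge i, hne⟩, b) = G.tip (x.edge i, b) := by rintro (_ | _) <;> rfl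
    rwa [h1, h1, x.tip_edge, x.tip_edge, cycle_tip_false, cycle_tip_true] at h
  -- Walk around the cycle from j + 1, modulo ℓ + 1: the ℓ steps avoid edge j and end at its other
  -- endpoint j.
  have hpath : ∀ t : ℕ, t ≤ ℓ → G'.underlying.Reachable (x.vert (j + 1))
      (x.vert (j + 1 + (t : Fin (ℓ + 1)))) := by
    intro t
    induction t with
    | zero => intro _; simp
    | succ t ih =>
      intro ht
      refine (ih (by omega)).trans ?_
      have hne : j + 1 + (t : Fin (ℓ + 1)) ≠ j := by
        intro h
        have h1 : ((t + 1 : ℕ) : Fin (ℓ + 1)) = 0 := by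
          have : j + ((t + 1 : ℕ) : Fin (ℓ + 1)) = j + 0 := by
            rw [add_zero]
            conv_rhs => rw [← h]
            push_cast; abel
          exact add_left_cancel this
        rw [Fin.natCast_eq_zero] at h1
        exact absurd (Nat.le_of_dvd (by omega) h1) (by omega)
      have := hstep _ hne
      have h2 : j + 1 + (t : Fin (ℓ + 1)) + 1 = j + 1 + ((t + 1 : ℕ) : Fin (ℓ + 1)) := by
        push_cast; abel
      rwa [h2] at this
  have hback : G'.underlying.Reachable (x.vert (j + 1)) (x.vert j) := by
    have h := hpath ℓ le_rfl
    have h2 : j + 1 + ((ℓ : ℕ) : Fin (ℓ + 1)) = j := by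
      have : ((ℓ + 1 : ℕ) : Fin (ℓ + 1)) = 0 := by simp
      push_cast at this
      rw [add_assoc, add_comm (1 : Fin (ℓ + 1)), this, add_zero]
    rwa [h2] at h
  refine hG.of_reachable_ends fun e => ?_
  by_cases he : e = x.edge j
  · subst he
    change G'.underlying.Reachable (G.tip (x.edge j, false)) (G.tip (x.edge j, true))
    rw [x.tip_edge', x.tip_edge']
    cases x.flip j
    · simpa only [Bool.false_xor, Bool.true_xor, Bool.not_true, Bool.not_false,
        cycle_tip_false, cycle_tip_true] using hback.symm
    · simpa only [Bool.false_xor, Bool.true_xor, Bool.not_true, Bool.not_false,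
        cycle_tip_false, cycle_tip_true] using hback
  · exact G'.reachable_tip ⟨e, he⟩ false true

/-- Transfers edge counts from simple graphs: an adjacency is recovered from its label, so such a
labelling is injective. -/
lemma exists_label {G : Multigraph V E} {T : SimpleGraph V} (hT : T ≤ G.underlying) :
    ∃ lab : T.edgeSet → E, ∀ a, s((G.ends (lab a)).1, (G.ends (lab a)).2) = a.1 := by
  have h : ∀ a : T.edgeSet, ∃ e, s((G.ends e).1, (G.ends e).2) = a.1 := by
    rintro ⟨a, ha⟩
    induction a with
    | _ u v => exact ((G.underlying_adj_iff u v).1 (hT ha)).2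
  exact ⟨fun a => (h a).choose, fun a => (h a).choose_spec⟩

lemma Connected.card_le [Fintype V] [Fintype E] {G : Multigraph V E} (hG : G.Connected) :
    Fintype.card V ≤ Fintype.card E + 1 := by
  obtain ⟨lab, hlab⟩ := exists_label (le_refl G.underlying)
  have hinj : Function.Injective lab := fun a b h => Subtype.ext (by rw [← hlab, ← hlab, h])
  have h1 := SimpleGraph.Connected.card_vert_le_card_edgeSet_add_one hG
  have h2 := Nat.card_le_card_of_injective lab hinj
  rw [Nat.card_eq_fintype_card (α := E)] at h2
  rw [Nat.card_eq_fintype_card] at h1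
  exact h1.trans (Nat.succ_le_succ h2)

/-- A connected multigraph with at least as many edges as vertices contains a cycle: an edge outside
a spanning tree, closed up through the tree. -/
lemma Connected.exists_cycle [Fintype V] [Fintype E] {G : Multigraph V E} (hG : G.Connected)
    (h : Fintype.card V ≤ Fintype.card E) : ∃ ℓ, Nonempty (Emb (cycle (ℓ + 1)) G) := by
  obtain ⟨T, hTG, hT⟩ := SimpleGraph.Connected.exists_isTree_le hG
  obtain ⟨lab, hlab⟩ := exists_label (G := G) hTG
  have hcard := (SimpleGraph.isTree_iff_connected_and_card.1 hT).2
  have hns : ¬ Function.Surjective lab := by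
    intro hs
    have := Nat.card_le_card_of_surjective lab hs
    rw [Nat.card_eq_fintype_card (α := E)] at this
    rw [Nat.card_eq_fintype_card (α := V)] at hcard
    omega
  obtain ⟨e₀, he₀⟩ : ∃ e₀, ∀ a, lab a ≠ e₀ := by
    simpa [Function.Surjective] using hns
  obtain ⟨p, hp⟩ := hT.connected.exists_isPath (G.ends e₀).1 (G.ends e₀).2
  have hinj := hp.getVert_injOn
  have hadj : ∀ i, i < p.length → s(p.getVert i, p.getVert (i + 1)) ∈ T.edgeSet := fun i hi =>
    p.adj_getVert_succ hi
  -- The last index carries the closing edge e₀. A loop e₀ gives a path of length 0, and an edge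
  -- parallel to a tree edge a path of length 1, so neither needs separate treatment.
  let ψ : Fin (p.length + 1) → E := fun i =>
    if hi : (i : ℕ) < p.length then lab ⟨_, hadj i hi⟩ else e₀
  have hψ : ∀ i, s((G.ends (ψ i)).1, (G.ends (ψ i)).2) =
      s(p.getVert (((cycle (p.length + 1)).ends i).1 : Fin _),
        p.getVert (((cycle (p.length + 1)).ends i).2 : Fin _)) := by
    intro i
    have h1 : ((cycle (p.length + 1)).ends i).2 = i + 1 := cycle_tip_true i
    rw [h1]
    change _ = s(p.getVert i, _)
    by_cases hi : (i : ℕ) < p.length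
    · have h2 : ψ i = lab ⟨_, hadj i hi⟩ := dif_pos hi
      rw [h2, hlab, Fin.val_add_one_of_lt (by rw [Fin.lt_def]; exact hi)]
    · have h2 : ψ i = e₀ := dif_neg hi
      obtain rfl : i = Fin.last _ := Fin.ext (by have := i.2; simp; omega)
      rw [h2, Fin.last_add_one]
      simp
  have hψinj : Function.Injective ψ := by
    intro i j hij
    simp only [ψ] at hij
    split_ifs at hij with h1 h2 h2
    · have h3 : (⟨_, hadj i h1⟩ : T.edgeSet) = ⟨_, hadj j h2⟩ :=
        Subtype.ext (by rw [← hlab, ← hlab, hij])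
      rw [Subtype.mk.injEq, Sym2.eq_iff] at h3
      rcases h3 with ⟨h3, -⟩ | ⟨h3, h4⟩
      · exact Fin.ext (hinj h1.le h2.le h3)
      · have h5 := hinj (x₁ := (i : ℕ)) h1.le (Nat.succ_le_of_lt h2) h3
        have h6 := hinj (x₁ := (i : ℕ) + 1) (Nat.succ_le_of_lt h1) h2.le h4
        omega
    · exact absurd hij (he₀ _)
    · exact absurd hij.symm (he₀ _)
    · exact Fin.ext (by have := i.2; have := j.2; omega)
  choose o ho using fun i => (sym2_ends_eq_iff G (cycle (p.length + 1))
    (fun i : Fin (p.length + 1) => p.getVert i) (ψ i) i).1 (hψ i)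
  exact ⟨p.length, ⟨⟨⟨fun i => p.getVert i, fun i j hij => Fin.ext
    (hinj (Nat.lt_succ_iff.1 i.2) (Nat.lt_succ_iff.1 j.2) hij)⟩, ⟨ψ, hψinj⟩, o, ho⟩⟩⟩

lemma Sub.IsCycle.exists_emb {G : Multigraph V E} {S : G.Sub} (hS : S.IsCycle) :
    ∃ ℓ, ∃ x : Emb (cycle (ℓ + 1)) G, x.image = S := by
  obtain ⟨ℓ, hℓ, x, hx⟩ := S.isCycle_iff.1 hS
  obtain ⟨ℓ, rfl⟩ := Nat.exists_eq_add_of_le' hℓ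
  exact ⟨ℓ, x, hx⟩

lemma Emb.isCycle_image {G : Multigraph V E} {ℓ : ℕ} (x : Emb (cycle (ℓ + 1)) G) :
    x.image.IsCycle := x.image.isCycle_iff.2 ⟨ℓ + 1, by omega, x, rfl⟩

lemma card_erase [Fintype E] [DecidableEq E] (e₀ : E) :
    Fintype.card {e // e ≠ e₀} + 1 = Fintype.card E := by
  have : 0 < Fintype.card E := Fintype.card_pos_iff.2 ⟨e₀⟩
  simp only [ne_eq, Fintype.card_subtype_compl, Fintype.card_unique]
  omega

/-- Deleting an edge of the cycle would leave a connected multigraph with too few edges. -/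
lemma Connected.not_cycle [Fintype V] [Fintype E] {G : Multigraph V E} (hG : G.Connected)
    (h : Fintype.card V = Fintype.card E + 1) {ℓ : ℕ} (x : Emb (cycle (ℓ + 1)) G) : False := by
  classical
  have h1 := (hG.erase_cycle x 0).card_le
  have h2 := card_erase (x.edge 0)
  omega

lemma Connected.isTree_iff [Fintype V] [Fintype E] {G : Multigraph V E} (hG : G.Connected) :
    G.IsTree ↔ Fintype.card V = Fintype.card E + 1 := by
  constructor
  · intro hT
    by_contra hne
    obtain ⟨ℓ, ⟨x⟩⟩ := hG.exists_cycle (by have := hG.card_le; omega)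
    exact hT.2 _ x.isCycle_image
  · refine fun h => ⟨hG, fun S hS => ?_⟩
    obtain ⟨ℓ, x, -⟩ := hS.exists_emb
    exact hG.not_cycle h x

lemma IsTree.no_loop {G : Multigraph V E} (hG : G.IsTree) (e : E) :
    (G.ends e).1 ≠ (G.ends e).2 := by
  intro h
  refine hG.2 _ (Emb.isCycle_image (ℓ := 0) ⟨⟨fun _ => (G.ends e).1, fun i j _ =>
    Subsingleton.elim (α := Fin 1) i j⟩, ⟨fun _ => e, fun i j _ =>
    Subsingleton.elim (α := Fin 1) i j⟩, fun _ => false, fun _ b => ?_⟩)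
  cases b
  · rfl
  · exact h.symm

/-- In a connected multigraph with as many edges as vertices, cycles are nested. -/
lemma Connected.edge_mem_of_cycles [Fintype V] [Fintype E] {G : Multigraph V E}
    (hG : G.Connected) (h : Fintype.card V = Fintype.card E) {k ℓ : ℕ}
    (x : Emb (cycle (k + 1)) G) (y : Emb (cycle (ℓ + 1)) G) (j : Fin (k + 1)) :
    x.edge j ∈ Set.range y.edge := by
  classical
  by_contra hj
  have hne : ∀ i, y.edge i ≠ x.edge j := fun i hi => hj ⟨i, hi⟩
  -- If y avoided this edge of x, it would survive the deletion, inside a connected multigraph with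
  -- one edge fewer than vertices.
  refine (hG.erase_cycle x j).not_cycle (by rw [h, card_erase]) (ℓ := ℓ)
    ⟨y.vert, ⟨fun i => ⟨y.edge i, hne i⟩, fun i i' hi =>
      y.edge.injective (Subtype.ext_iff.1 hi)⟩, y.flip, fun i b => ?_⟩
  rw [← y.tip_edge]
  rfl

lemma Emb.image_eq_of_range_edge {G : Multigraph V E} {k ℓ : ℕ} (x : Emb (cycle k) G)
    (y : Emb (cycle ℓ) G) (h : Set.range x.edge ⊆ Set.range y.edge) :
    Set.range x.vert ⊆ Set.range y.vert := by
  rintro _ ⟨i, rfl⟩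
  obtain ⟨i', hi'⟩ := h ⟨i, rfl⟩
  have h1 := x.tip_edge i false
  rw [← hi', y.tip_edge', cycle_tip_false] at h1
  exact ⟨_, h1⟩

lemma Connected.isUnicycle [Fintype V] [Fintype E] {G : Multigraph V E}
    (hG : G.Connected) (h : Fintype.card V = Fintype.card E) : G.IsUnicycle := by
  obtain ⟨ℓ, ⟨x⟩⟩ := hG.exists_cycle h.le
  refine ⟨hG, x.image, x.isCycle_image, fun S hS => ?_⟩
  obtain ⟨k, y, rfl⟩ := hS.exists_emb
  have h1 : Set.range x.edge ⊆ Set.range y.edge := by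
    rintro _ ⟨j, rfl⟩; exact hG.edge_mem_of_cycles h x y j
  have h2 : Set.range y.edge ⊆ Set.range x.edge := by
    rintro _ ⟨j, rfl⟩; exact hG.edge_mem_of_cycles h y x j
  exact Sub.ext_sets ((y.image_eq_of_range_edge x h2).antisymm (x.image_eq_of_range_edge y h1))
    (h2.antisymm h1)

/-- A connected multigraph that is neither a tree nor a unicycle has more edges than vertices. -/
theorem Connected.card_lt [Fintype V] [Fintype E] {G : Multigraph V E} (hG : G.Connected)
    (hT : ¬ G.IsTree) (hU : ¬ G.IsUnicycle) : Fintype.card V < Fintype.card E := by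
  have h1 := hG.card_le
  rw [hG.isTree_iff] at hT
  have h2 : Fintype.card V ≠ Fintype.card E := fun h => hU (hG.isUnicycle h)
  omega

end Multigraph

/-! ### Symmetries of cycles, and overlapping cycles. -/

namespace Multigraph

variable {V E V₁ E₁ : Type}

section Dihedral

open scoped Fin.CommRing

variable {ℓ : ℕ}

lemma fin_induction_add_one {p : Fin (ℓ + 1) → Prop} (h0 : p 0) (h1 : ∀ i, p i → p (i + 1))
    (i : Fin (ℓ + 1)) : p i := by
  have h : ∀ t : ℕ, p (t : Fin (ℓ + 1)) := by
    intro t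
    induction t with
    | zero => simpa using h0
    | succ t ih => rw [Nat.cast_succ]; exact h1 _ ih
  have := h i
  rwa [Fin.cast_val_eq_self] at this

lemma Emb.cycle_start (x : Emb (cycle (ℓ + 1)) (cycle (ℓ + 1))) (i : Fin (ℓ + 1)) :
    x.vert i = bif x.flip i then x.edge i + 1 else x.edge i := by
  have h := x.tip_edge i false
  cases hf : x.flip i <;> rw [hf] at h
  · exact h.symm
  · exact h.symm.trans (cycle_tip_true _)

lemma Emb.cycle_end (x : Emb (cycle (ℓ + 1)) (cycle (ℓ + 1))) (i : Fin (ℓ + 1)) :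
    x.vert (i + 1) = bif x.flip i then x.edge i else x.edge i + 1 := by
  have h := x.tip_edge i true
  rw [cycle_tip_true] at h
  cases hf : x.flip i <;> rw [hf] at h
  · exact h.symm.trans (cycle_tip_true _)
  · exact h.symm

/-- A change of direction between consecutive edges would send both to the same edge, against
injectivity. -/
lemma Emb.cycle_flip (x : Emb (cycle (ℓ + 1)) (cycle (ℓ + 1))) (i : Fin (ℓ + 1)) :
    x.flip i = x.flip 0 := by
  refine fin_induction_add_one (p := fun i => x.flip i = x.flip 0) rfl (fun i hi => ?_) i
  rw [← hi]
  by_contra hne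
  have h1 := x.cycle_end i
  rw [x.cycle_start (i + 1)] at h1
  have h2 : x.edge (i + 1) = x.edge i := by
    cases ha : x.flip i <;> cases hb : x.flip (i + 1) <;> rw [ha, hb] at h1 hne
    · exact absurd rfl hne
    · exact add_right_cancel h1
    · exact h1
    · exact absurd rfl hne
  have h3 := x.edge.injective h2
  rw [h3] at hne
  exact hne rfl

/-- The orientation-tracking automorphisms of a cycle form a dihedral group. -/
theorem card_emb_cycle_self : Nat.card (Emb (cycle (ℓ + 1)) (cycle (ℓ + 1))) = 2 * (ℓ + 1) := by
  have hcard : Nat.card (Fin (ℓ + 1) × Bool) = 2 * (ℓ + 1) := by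
    simp [mul_comm]
  rw [← hcard]
  refine Nat.card_eq_of_bijective (fun x => (x.vert 0, x.flip 0)) ⟨fun x y h => ?_, ?_⟩
  · obtain ⟨h1, h2⟩ := Prod.ext_iff.1 h
    simp only at h1 h2
    have hf : x.flip = y.flip := by
      funext i; rw [x.cycle_flip, y.cycle_flip, h2]
    have hedge : ∀ i, x.vert i = y.vert i → x.edge i = y.edge i := by
      intro i hi
      rw [x.cycle_start, y.cycle_start, hf] at hi
      cases hb : y.flip i <;> rw [hb] at hi
      · exact hi
      · exact add_right_cancel hi
    have hv : ∀ i, x.vert i = y.vert i := by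
      refine fin_induction_add_one h1 fun i hi => ?_
      rw [x.cycle_end, y.cycle_end, hf, hedge i hi]
    exact Emb.ext (DFunLike.ext _ _ hv) (DFunLike.ext _ _ fun i => hedge i (hv i)) hf
  · rintro ⟨j, _ | _⟩
    · refine ⟨⟨(Equiv.addRight j).toEmbedding, (Equiv.addRight j).toEmbedding, fun _ => false,
        fun i b => ?_⟩, ?_⟩
      · cases b
        · rfl
        · rw [cycle_tip_true]
          change (cycle (ℓ + 1)).tip (i + j, true) = i + 1 + j
          rw [cycle_tip_true]; ring
      · simp
    -- The reflection i ↦ j - i of the vertices sends the edge from i to i + 1 to the edge from j -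
    -- 1 - i to j - i, reversed.
    · refine ⟨⟨(Equiv.subLeft j).toEmbedding, (Equiv.subLeft (j - 1)).toEmbedding, fun _ => true,
        fun i b => ?_⟩, ?_⟩
      · cases b
        · change (cycle (ℓ + 1)).tip (j - 1 - i, true) = j - i
          rw [cycle_tip_true]; ring
        · rw [cycle_tip_true]
          change j - 1 - i = j - (i + 1)
          ring
      · simp

/-- At each vertex of a cycle there are two half-edges of the cycle. -/
lemma Emb.exists_two_halfEdges {G : Multigraph V E} (x : Emb (cycle (ℓ + 1)) G) {v : V}
    (hv : v ∈ x.image.verts) : ∃ h h' : E × Bool, h ≠ h' ∧ G.tip h = v ∧ G.tip h' = v ∧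
      h.1 ∈ x.image.edges ∧ h'.1 ∈ x.image.edges := by
  obtain ⟨i, rfl⟩ := hv
  -- These are the start of edge i and the end of edge i - 1, distinct even for a loop, where the
  -- two edges coincide.
  refine ⟨(x.edge i, xor (x.flip i) false), (x.edge (i - 1), xor (x.flip (i - 1)) true), ?_, ?_,
    ?_, ⟨i, rfl⟩, ⟨i - 1, rfl⟩⟩
  · intro h
    obtain ⟨h1, h2⟩ := Prod.ext_iff.1 h
    have h3 := x.edge.injective h1
    simp only [← h3] at h2
    cases hb : x.flip i <;> rw [hb] at h2 <;> simp at h2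
  · rw [x.tip_edge, cycle_tip_false]
  · rw [x.tip_edge, cycle_tip_true, sub_add_cancel]

/-- Two distinct cycles of the same length that meet branch off at a common vertex. -/
lemma Emb.exists_branch [Finite V] [Finite E] {G : Multigraph V E} (x y : Emb (cycle (ℓ + 1)) G)
    (hne : x.image ≠ y.image) (hmeet : ¬ Disjoint x.image.verts y.image.verts) :
    ∃ h : E × Bool, G.tip h ∈ x.image.verts ∧ h.1 ∈ y.image.edges ∧ h.1 ∉ x.image.edges := by
  -- Otherwise y can be followed from the common vertex all the way round without leaving x, and the
  -- equal lengths force the two images to coincide.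
  by_contra! hcon
  apply hne
  obtain ⟨v, hvx, ⟨i₀, rfl⟩⟩ := Set.not_disjoint_iff.1 hmeet
  have hedge : ∀ i, y.vert i ∈ x.image.verts → y.edge i ∈ x.image.edges := by
    intro i hi
    refine hcon (y.edge i, xor (y.flip i) false) ?_ ⟨i, rfl⟩
    rw [y.tip_edge, cycle_tip_false]
    exact hi
  have hvert : ∀ i, y.vert (i₀ + i) ∈ x.image.verts := by
    refine fin_induction_add_one (by simpa using hvx) fun i hi => ?_
    have h1 := x.image.tip_mem (hedge _ hi) (xor (y.flip (i₀ + i)) true)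
    rwa [y.tip_edge, cycle_tip_true, add_assoc] at h1
  have hvert' : ∀ i, y.vert i ∈ x.image.verts := fun i => by
    have := hvert (i - i₀)
    rwa [add_sub_cancel] at this
  have c1 : ∀ z : Emb (cycle (ℓ + 1)) G, z.image.verts.ncard = ℓ + 1 := fun z => by
    change (Set.range z.vert).ncard = _
    rw [← Nat.card_coe_set_eq, Nat.card_range_of_injective z.vert.injective, Nat.card_eq_fintype_card,
      Fintype.card_fin]
  have c2 : ∀ z : Emb (cycle (ℓ + 1)) G, z.image.edges.ncard = ℓ + 1 := fun z => by
    change (Set.range z.edge).ncard = _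
    rw [← Nat.card_coe_set_eq, Nat.card_range_of_injective z.edge.injective, Nat.card_eq_fintype_card,
      Fintype.card_fin]
  refine (Sub.ext_sets (Set.eq_of_subset_of_ncard_le ?_ (by rw [c1, c1]))
    (Set.eq_of_subset_of_ncard_le ?_ (by rw [c2, c2]))).symm
  · rintro _ ⟨i, rfl⟩; exact hvert' i
  · rintro _ ⟨i, rfl⟩; exact hedge i (hvert' i)

end Dihedral

/-- The union of a family of subgraphs. -/
def Sub.iUnion {ι : Type*} {G : Multigraph V E} (τ : ι → G.Sub) : G.Sub where
  verts := ⋃ a, (τ a).verts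
  edges := ⋃ a, (τ a).edges
  closed e he := by
    obtain ⟨a, ha⟩ := Set.mem_iUnion.1 he
    exact ⟨Set.mem_iUnion.2 ⟨a, ((τ a).closed e ha).1⟩, Set.mem_iUnion.2 ⟨a, ((τ a).closed e ha).2⟩⟩

/-- A union of cycles of a given length, not all of them vertex-disjoint, has more edges than
vertices. -/
theorem Sub.ncard_verts_lt_of_overlap [Finite V] [Finite E] {ι : Type*} {G : Multigraph V E} {ℓ : ℕ}
    (x : ι → Emb (cycle (ℓ + 1)) G) {a b : ι} (hne : (x a).image ≠ (x b).image)
    (hmeet : ¬ Disjoint (x a).image.verts (x b).image.verts) :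
    (Sub.iUnion fun a => (x a).image).verts.ncard <
      (Sub.iUnion fun a => (x a).image).edges.ncard := by
  classical
  have := Fintype.ofFinite V
  have := Fintype.ofFinite E
  set U := Sub.iUnion fun a => (x a).image
  have hmemE : ∀ {a e}, e ∈ (x a).image.edges → e ∈ U.edges := fun h => Set.mem_iUnion.2 ⟨_, h⟩
  have hmemV : ∀ {a v}, v ∈ (x a).image.verts → v ∈ U.verts := fun h => Set.mem_iUnion.2 ⟨_, h⟩
  -- Double count the half-edges of the union: they number twice its edges, every vertex has at
  -- least two, and the branching vertex has a third.
  let A : Finset (E × Bool) := Finset.univ.filter fun h => h.1 ∈ U.edges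
  have hA : A.card = 2 * U.edges.ncard := by
    have : A = U.edges.toFinset ×ˢ (Finset.univ : Finset Bool) := by
      ext h; simp [A]
    rw [this, Finset.card_product, Set.ncard_eq_toFinset_card', Finset.card_univ, Fintype.card_bool,
      mul_comm]
  have hfib : A.card = ∑ v ∈ U.verts.toFinset, (A.filter fun h => G.tip h = v).card := by
    refine Finset.card_eq_sum_card_fiberwise fun h hh => ?_
    simp only [A, Finset.coe_filter, Finset.mem_univ, true_and, Set.mem_ofPred_eq] at hh
    simpa using U.tip_mem hh h.2
  have htwo : ∀ v ∈ U.verts.toFinset, 2 ≤ (A.filter fun h => G.tip h = v).card := by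
    intro v hv
    obtain ⟨c, hc⟩ := Set.mem_iUnion.1 (Set.mem_toFinset.1 hv)
    obtain ⟨h, h', hhh, h1, h2, h3, h4⟩ := (x c).exists_two_halfEdges hc
    refine Finset.one_lt_card.2 ⟨h, ?_, h', ?_, hhh⟩
    · simpa [A, h1] using hmemE h3
    · simpa [A, h2] using hmemE h4
  obtain ⟨k, hk1, hk2, hk3⟩ := (x a).exists_branch (x b) hne hmeet
  have hthree : 2 < (A.filter fun h => G.tip h = G.tip k).card := by
    obtain ⟨h, h', hhh, h1, h2, h3, h4⟩ := (x a).exists_two_halfEdges hk1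
    refine Finset.two_lt_card.2 ⟨h, ?_, h', ?_, k, ?_, hhh, ?_, ?_⟩
    · simpa [A, h1] using hmemE h3
    · simpa [A, h2] using hmemE h4
    · simpa [A] using hmemE hk2
    · rintro rfl; exact hk3 h3
    · rintro rfl; exact hk3 h4
  have hlt : ∑ v ∈ U.verts.toFinset, 2 < A.card := by
    rw [hfib]
    exact Finset.sum_lt_sum htwo ⟨G.tip k, Set.mem_toFinset.2 (hmemV hk1), hthree⟩
  rw [Finset.sum_const, smul_eq_mul, ← Set.ncard_eq_toFinset_card', hA] at hlt
  omega

/-! ### Disjoint copies and factorial moments. -/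

/-- The disjoint union of `t` copies of a multigraph. -/
def copies (t : ℕ) (H : Multigraph V E) : Multigraph (Fin t × V) (Fin t × E) where
  ends p := ((p.1, (H.ends p.2).1), (p.1, (H.ends p.2).2))

lemma copies_tip (t : ℕ) (H : Multigraph V E) (a : Fin t) (e : E) (b : Bool) :
    (copies t H).tip ((a, e), b) = (a, H.tip (e, b)) := by
  cases b <;> rfl

/-- Embeddings of `t` disjoint copies of `H` are `t`-tuples of disjoint embeddings of `H`. -/
def copiesEmbEquiv (t : ℕ) (H : Multigraph V E) (G : Multigraph V₁ E₁) :
    Emb (copies t H) G ≃ {x : Fin t → Emb H G //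
      Pairwise fun a b => Disjoint (x a).image.verts (x b).image.verts} where
  toFun x := ⟨fun a =>
    { vert := ⟨fun v => x.vert (a, v), fun v w h => (Prod.ext_iff.1 (x.vert.injective h)).2⟩
      edge := ⟨fun e => x.edge (a, e), fun v w h => (Prod.ext_iff.1 (x.edge.injective h)).2⟩
      flip := fun e => x.flip (a, e)
      tip_edge := fun e b => by
        have := x.tip_edge (a, e) b
        rw [copies_tip] at this
        exact this }, by
    intro a b hab
    rw [Set.disjoint_left]
    rintro _ ⟨v, rfl⟩ ⟨w, hw⟩
    exact hab (Prod.ext_iff.1 (x.vert.injective hw)).1.symm⟩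
  invFun x :=
    { vert := ⟨fun p => (x.1 p.1).vert p.2, by
        rintro ⟨a, v⟩ ⟨b, w⟩ h
        by_cases hab : a = b
        · subst hab; exact congrArg (Prod.mk a) ((x.1 a).vert.injective h)
        · exact absurd h fun h' => Set.disjoint_left.1 (x.2 hab) ⟨v, rfl⟩ ⟨w, h'.symm⟩⟩
      edge := ⟨fun p => (x.1 p.1).edge p.2, by
        rintro ⟨a, e⟩ ⟨b, f⟩ h
        by_cases hab : a = b
        · subst hab; exact congrArg (Prod.mk a) ((x.1 a).edge.injective h)
        · refine absurd ((x.1 a).image.tip_mem ⟨e, rfl⟩ false) (Set.disjoint_right.1 (x.2 hab) ?_)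
          exact (x.1 b).image.tip_mem ⟨f, h.symm⟩ false⟩
      flip := fun p => (x.1 p.1).flip p.2
      tip_edge := fun e b => by
        rw [copies_tip]
        exact (x.1 e.1).tip_edge e.2 b }
  left_inv _ := rfl
  right_inv _ := rfl

/-- The `H`-subgraphs of `G`. -/
abbrev Copy (G : Multigraph V₁ E₁) (H : Multigraph V E) : Type :=
  {S : G.Sub // Nonempty (Iso S.toMultigraph H)}

/-- The vertex-disjointness of a tuple of subgraphs. -/
def DisjointTuple {G : Multigraph V₁ E₁} {H : Multigraph V E} {t : ℕ}
    (τ : Fin t → G.Copy H) : Prop :=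
  Pairwise fun a b => Disjoint (τ a).1.verts (τ b).1.verts

/-- Disjointness depends only on the images, so each of the t components has its self-embedding
free. -/
theorem card_emb_copies [Finite V] [Finite E] [Finite V₁] [Finite E₁] (t : ℕ) (H : Multigraph V E)
    (G : Multigraph V₁ E₁) : Nat.card (Emb (copies t H) G) =
      Nat.card {τ : Fin t → G.Copy H // DisjointTuple τ} * Nat.card (Emb H H) ^ t := by
  obtain ⟨f, hf⟩ := exists_embEquiv H G
  have e1 : {x : Fin t → Emb H G // Pairwise fun a b => Disjoint (x a).image.verts
      (x b).image.verts} ≃ {p : (Fin t → G.Copy H) × (Fin t → Emb H H) // DisjointTuple p.1} :=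
    ((Equiv.arrowCongr (Equiv.refl _) f).trans (Equiv.arrowProdEquivProdArrow _ _ _)).subtypeEquiv
      fun x => by
        simp only [DisjointTuple, ← hf]
        rfl
  have e2 : {p : (Fin t → G.Copy H) × (Fin t → Emb H H) // DisjointTuple p.1} ≃
      {τ : Fin t → G.Copy H // DisjointTuple τ} × (Fin t → Emb H H) :=
    { toFun := fun p => (⟨p.1.1, p.2⟩, p.1.2)
      invFun := fun p => ⟨(p.1.1, p.2), p.1.2⟩
      left_inv := fun _ => rfl
      right_inv := fun _ => rfl }
  rw [Nat.card_congr (((copiesEmbEquiv t H G).trans e1).trans e2), Nat.card_prod, Nat.card_fun,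
    Nat.card_eq_fintype_card (α := Fin t), Fintype.card_fin]

/-- The factorial moments of the number of `H`-subgraphs count disjoint and overlapping tuples. -/
theorem descFactorial_count [Finite V₁] [Finite E₁] [Nonempty V] (t : ℕ) (H : Multigraph V E)
    (G : Multigraph V₁ E₁) : (G.count H).descFactorial t =
      Nat.card {τ : Fin t → G.Copy H // DisjointTuple τ} +
      Nat.card {τ : Fin t → G.Copy H // Function.Injective τ ∧ ¬ DisjointTuple τ} := by
  classical
  have := Fintype.ofFinite (G.Copy H)
  have h1 : (G.count H).descFactorial t = Nat.card (Fin t ↪ G.Copy H) := by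
    rw [Nat.card_eq_fintype_card, Fintype.card_embedding_eq, Fintype.card_fin, count,
      ← Nat.card_eq_fintype_card]
  -- A subgraph with a vertex is not disjoint from itself; this is where `Nonempty V` enters.
  have hinj : ∀ τ : Fin t → G.Copy H, DisjointTuple τ → Function.Injective τ := by
    intro τ hτ a b hab
    by_contra hne
    have h2 : Disjoint (τ a).1.verts (τ b).1.verts := hτ hne
    rw [hab, disjoint_self] at h2
    obtain ⟨x, hx⟩ := (nonempty_iso_iff _ _).1 (τ b).2
    have h3 : x.vert (Classical.arbitrary V) ∈ (τ b).1.verts := by rw [← hx]; exact ⟨_, rfl⟩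
    rw [h2] at h3
    exact h3
  rw [h1, Nat.card_congr (Equiv.subtypeInjectiveEquivEmbedding _ _).symm,
    Nat.card_congr (Equiv.sumCompl fun τ : {τ : Fin t → G.Copy H // Function.Injective τ} =>
      DisjointTuple τ.1).symm, Nat.card_sum]
  congr 1
  · exact Nat.card_congr ((Equiv.subtypeSubtypeEquivSubtypeInter _ _).trans
      (Equiv.subtypeEquivRight fun τ => ⟨fun h => h.2, fun h => ⟨hinj τ h, h⟩⟩))
  · exact Nat.card_congr (Equiv.subtypeSubtypeEquivSubtypeInter _ fun τ => ¬ DisjointTuple τ)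

end Multigraph

/-! ### Overlapping tuples bounded by dense subgraphs. -/

namespace Multigraph

variable {V E : Type}

/-- Subgraphs with more edges than vertices, and with at most `M` edges. -/
abbrev DenseSub (G : Multigraph V E) (M : ℕ) : Type :=
  {S : G.Sub // S.verts.ncard < S.edges.ncard ∧ S.edges.ncard ≤ M}

lemma Sub.exists_iso_fin [Finite V] [Finite E] {G : Multigraph V E} (S : G.Sub) :
    ∃ F : Multigraph (Fin S.verts.ncard) (Fin S.edges.ncard), Nonempty (Iso S.toMultigraph F) := by
  let f : S.verts ≃ Fin S.verts.ncard := Finite.equivFinOfCardEq (Nat.card_coe_set_eq _)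
  let g : S.edges ≃ Fin S.edges.ncard := Finite.equivFinOfCardEq (Nat.card_coe_set_eq _)
  exact ⟨⟨fun e => (f (S.toMultigraph.ends (g.symm e)).1, f (S.toMultigraph.ends (g.symm e)).2)⟩,
    ⟨⟨f, g, fun e => by simp⟩⟩⟩

/-- A union bound over models on `Fin k` and `Fin s` with k < s ≤ M: a finite list that does not
depend on G. -/
lemma card_denseSub_le [Finite V] [Finite E] (G : Multigraph V E) (M : ℕ) :
    Nat.card (G.DenseSub M) ≤ ∑ s ∈ Finset.range (M + 1), ∑ k ∈ Finset.range s,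
      ∑ F : Multigraph (Fin k) (Fin s), G.count F := by
  classical
  have := Fintype.ofFinite G.Sub
  rw [Nat.card_eq_fintype_card, Fintype.card_subtype]
  have h : (Finset.univ.filter fun S : G.Sub => S.verts.ncard < S.edges.ncard ∧
      S.edges.ncard ≤ M) ⊆ (Finset.range (M + 1)).biUnion fun s => (Finset.range s).biUnion fun k =>
      (Finset.univ : Finset (Multigraph (Fin k) (Fin s))).biUnion fun F =>
        Finset.univ.filter fun S : G.Sub => Nonempty (Iso S.toMultigraph F) := by
    intro S hS
    simp only [Finset.mem_filter, Finset.mem_univ, true_and] at hS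
    obtain ⟨F, hF⟩ := S.exists_iso_fin
    simp only [Finset.mem_biUnion, Finset.mem_range, Finset.mem_filter, Finset.mem_univ, true_and]
    exact ⟨_, Nat.lt_succ_of_le hS.2, _, hS.1, F, hF⟩
  refine (Finset.card_le_card h).trans (Finset.card_biUnion_le.trans
    (Finset.sum_le_sum fun s _ => Finset.card_biUnion_le.trans (Finset.sum_le_sum fun k _ =>
      Finset.card_biUnion_le.trans (Finset.sum_le_sum fun F _ => le_of_eq ?_))))
  rw [count, Nat.card_eq_fintype_card, Fintype.card_subtype]

/-- Tuples of cycles that overlap are dominated by dense subgraphs. -/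
theorem card_overlap_le [Finite V] [Finite E] (G : Multigraph V E) (t ℓ : ℕ) :
    Nat.card {τ : Fin t → G.Copy (cycle (ℓ + 1)) // Function.Injective τ ∧ ¬ DisjointTuple τ} ≤
      (2 ^ (t * (ℓ + 1)) * 2 ^ (t * (ℓ + 1))) ^ t * Nat.card (G.DenseSub (t * (ℓ + 1))) := by
  classical
  set M := t * (ℓ + 1) with hM
  have := Fintype.ofFinite (G.DenseSub M)
  have := Fintype.ofFinite
    {τ : Fin t → G.Copy (cycle (ℓ + 1)) // Function.Injective τ ∧ ¬ DisjointTuple τ}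
  have hU : ∀ τ : {τ : Fin t → G.Copy (cycle (ℓ + 1)) // Function.Injective τ ∧ ¬ DisjointTuple τ},
      (Sub.iUnion fun a => (τ.1 a).1).verts.ncard < (Sub.iUnion fun a => (τ.1 a).1).edges.ncard ∧
      (Sub.iUnion fun a => (τ.1 a).1).edges.ncard ≤ M := by
    rintro ⟨τ, hinj, hdis⟩
    choose x hx using fun a => (nonempty_iso_iff _ _).1 (τ a).2
    simp only [← hx]
    constructor
    · simp only [DisjointTuple, Pairwise, not_forall] at hdis
      obtain ⟨a, b, hab, hdis⟩ := hdis
      refine Sub.ncard_verts_lt_of_overlap x (a := a) (b := b) (fun h => hab (hinj ?_)) ?_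
      · rw [hx, hx] at h
        exact Subtype.ext h
      · rwa [hx, hx]
    · have hr : (Sub.iUnion fun a => (x a).image).edges =
          Set.range fun p : Fin t × Fin (ℓ + 1) => (x p.1).edge p.2 := by
        ext e
        simp [Sub.iUnion, Emb.image]
      rw [hr, ← Nat.card_coe_set_eq]
      refine (Finite.card_range_le _).trans (le_of_eq ?_)
      simp [hM]
  rw [Nat.card_eq_fintype_card, Nat.card_eq_fintype_card, ← Finset.card_univ, ← Finset.card_univ]
  -- Send a tuple to its union. Within a fibre, the tuple is determined by t pairs of a vertex
  -- subset and an edge subset of a union with at most M of each, which gives the constant.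
  let f : {τ : Fin t → G.Copy (cycle (ℓ + 1)) // Function.Injective τ ∧ ¬ DisjointTuple τ} →
      G.DenseSub M := fun τ => ⟨Sub.iUnion fun a => (τ.1 a).1, hU τ⟩
  refine Finset.card_le_mul_card_image_of_maps_to (f := f)
    (fun _ _ => Finset.mem_univ _) _ fun U _ => ?_
  rw [← Fintype.card_subtype, ← Nat.card_eq_fintype_card]
  have hcard : Nat.card (Fin t → Set U.1.verts × Set U.1.edges) ≤ (2 ^ M * 2 ^ M) ^ t := by
    have := Fintype.ofFinite U.1.verts
    have := Fintype.ofFinite U.1.edges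
    have h1 : Fintype.card U.1.verts = U.1.verts.ncard := by
      rw [← Nat.card_eq_fintype_card, Nat.card_coe_set_eq]
    have h2 : Fintype.card U.1.edges = U.1.edges.ncard := by
      rw [← Nat.card_eq_fintype_card, Nat.card_coe_set_eq]
    rw [Nat.card_eq_fintype_card, Fintype.card_fun, Fintype.card_prod, Fintype.card_set,
      Fintype.card_set, Fintype.card_fin, h1, h2]
    exact Nat.pow_le_pow_left (Nat.mul_le_mul
      (Nat.pow_le_pow_right two_pos (U.2.1.le.trans U.2.2))
      (Nat.pow_le_pow_right two_pos U.2.2)) t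
  let g : {τ // f τ = U} →
      Fin t → Set U.1.verts × Set U.1.edges := fun τ a =>
    (Subtype.val ⁻¹' (τ.1.1 a).1.verts, Subtype.val ⁻¹' (τ.1.1 a).1.edges)
  suffices hg : Function.Injective g from (Nat.card_le_card_of_injective g hg).trans hcard
  rintro ⟨τ, hτ⟩ ⟨τ', hτ'⟩ h
  refine Subtype.ext (Subtype.ext (funext fun a => Subtype.ext ?_))
  have ha := Prod.ext_iff.1 (congrFun h a)
  have hsubV : ∀ σ : {τ : Fin t → G.Copy (cycle (ℓ + 1)) //
      Function.Injective τ ∧ ¬ DisjointTuple τ},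
      f σ = U →
      (σ.1 a).1.verts ⊆ U.1.verts := by
    rintro σ rfl
    exact Set.subset_iUnion (fun a => (σ.1 a).1.verts) a
  have hsubE : ∀ σ : {τ : Fin t → G.Copy (cycle (ℓ + 1)) //
      Function.Injective τ ∧ ¬ DisjointTuple τ},
      f σ = U →
      (σ.1 a).1.edges ⊆ U.1.edges := by
    rintro σ rfl
    exact Set.subset_iUnion (fun a => (σ.1 a).1.edges) a
  refine Sub.ext_sets ?_ ?_
  · ext v
    refine ⟨fun hv => ?_, fun hv => ?_⟩
    · exact (Set.ext_iff.1 ha.1 ⟨v, hsubV τ hτ hv⟩).1 hv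
    · exact (Set.ext_iff.1 ha.1 ⟨v, hsubV τ' hτ' hv⟩).2 hv
  · ext e
    refine ⟨fun he => ?_, fun he => ?_⟩
    · exact (Set.ext_iff.1 ha.2 ⟨e, hsubE τ hτ he⟩).1 he
    · exact (Set.ext_iff.1 ha.2 ⟨e, hsubE τ' hτ' he⟩).2 he

lemma card_fiber_of_bijective {α β : Type*} {f : α → β} (hf : Function.Bijective f) (b : β) :
    Nat.card {a // f a = b} = 1 := by
  rw [Nat.card_eq_one_iff_unique]
  obtain ⟨a, ha, hu⟩ := hf.existsUnique b
  exact ⟨⟨fun x y => Subtype.ext ((hu _ x.2).trans (hu _ y.2).symm)⟩, ⟨⟨a, ha⟩⟩⟩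

lemma degree_copies_cycle (t ℓ : ℕ) (v : Fin t × Fin ℓ) : (copies t (cycle ℓ)).degree v = 2 := by
  rw [degree]
  have h1 : Function.Bijective fun e => ((copies t (cycle ℓ)).ends e).1 := Function.bijective_id
  have h2 : Function.Bijective fun e => ((copies t (cycle ℓ)).ends e).2 :=
    (Equiv.prodCongr (Equiv.refl (Fin t)) (finRotate ℓ)).bijective
  rw [card_fiber_of_bijective h1, card_fiber_of_bijective h2]

end Multigraph

/-! ### Poisson convergence from factorial moments -/

/-- Bonferroni's inequality. The summand equals C(x,t) C(x-t,j), and for x - t = y + 1 the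
alternating partial sum of the C(y+1,j) collapses to ±C(y,r), which is at most C(y+1,r+1). -/
lemma abs_indicator_sub_sum_choose_le (x t r : ℕ) :
    |(if x = t then (1 : ℝ) else 0) -
      ∑ j ∈ Finset.range (r + 1), (-1) ^ j * ((x.choose (t + j) * (t + j).choose t : ℕ) : ℝ)| ≤
      ((x.choose (t + (r + 1)) * (t + (r + 1)).choose t : ℕ) : ℝ) := by
  have hmul : ∀ j, x.choose (t + j) * (t + j).choose t = x.choose t * (x - t).choose j := by
    intro j
    rw [Nat.choose_mul (Nat.le_add_right t j), Nat.add_sub_cancel_left]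
  simp only [hmul]
  rcases lt_trichotomy x t with h | rfl | h
  · rw [Nat.choose_eq_zero_of_lt h]
    simp [h.ne]
  · simp [Finset.sum_range_succ']
  · obtain ⟨y, hy⟩ : ∃ y, x - t = y + 1 := ⟨x - t - 1, by omega⟩
    rw [hy, if_neg h.ne']
    have h1 : ∑ j ∈ Finset.range (r + 1), (-1 : ℝ) ^ j * ((x.choose t * (y + 1).choose j : ℕ) : ℝ) =
        x.choose t * ((-1) ^ r * y.choose r) := by
      have h2 : (∑ k ∈ Finset.range (r + 1), ((-1 : ℝ) ^ k * ((y + 1).choose k : ℝ))) =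
          (-1) ^ r * y.choose r := by
        exact_mod_cast congrArg (Int.cast : ℤ → ℝ)
          (Int.alternating_sum_range_choose_eq_choose (n := y) (m := r))
      rw [← h2, Finset.mul_sum]
      refine Finset.sum_congr rfl fun j _ => ?_
      push_cast; ring
    rw [h1, zero_sub, abs_neg, abs_mul, abs_mul, abs_pow, abs_neg, abs_one, one_pow, one_mul,
      Nat.abs_cast, Nat.abs_cast]
    push_cast
    refine mul_le_mul_of_nonneg_left ?_ (Nat.cast_nonneg _)
    rw [Nat.choose_succ_succ]
    push_cast
    linarith [(Nat.cast_nonneg (y.choose (r + 1)) : (0 : ℝ) ≤ _)]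

lemma choose_mul_choose_eq (x t j : ℕ) : ((x.choose (t + j) * (t + j).choose t : ℕ) : ℝ) =
    (x.descFactorial (t + j) : ℝ) / (t.factorial * j.factorial) := by
  have h1 : ((t + j).factorial : ℝ) ≠ 0 := by positivity
  have h2 : (x.descFactorial (t + j) : ℝ) = (t + j).factorial * x.choose (t + j) := by
    exact_mod_cast Nat.descFactorial_eq_factorial_mul_choose x (t + j)
  have h3 : ((t + j).choose t : ℝ) * t.factorial * j.factorial = (t + j).factorial := by
    have := Nat.choose_mul_factorial_mul_factorial (Nat.le_add_right t j)
    rw [Nat.add_sub_cancel_left] at this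
    exact_mod_cast this
  rw [h2, ← h3]
  push_cast
  field_simp

/-- Convergence to a Poisson probability from bounds of Bonferroni type. -/
lemma tendsto_poisson_of_bonferroni {p : ℕ → ℝ} {M : ℕ → ℕ → ℝ} {μ : ℝ} (t : ℕ)
    (hM : ∀ j, Tendsto (M j) atTop (𝓝 (μ ^ j)))
    (hb : ∀ n r, |p n - ∑ j ∈ Finset.range (r + 1),
      (-1) ^ j * (M (t + j) n / (t.factorial * j.factorial))| ≤
        M (t + (r + 1)) n / (t.factorial * (r + 1).factorial)) :
    Tendsto p atTop (𝓝 (Real.exp (-μ) * μ ^ t / t.factorial)) := by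
  set L := Real.exp (-μ) * μ ^ t / t.factorial
  have hS : Tendsto (fun r => ∑ j ∈ Finset.range (r + 1),
      (-1) ^ j * (μ ^ (t + j) / (t.factorial * j.factorial))) atTop (𝓝 L) := by
    have h1 := (NormedSpace.expSeries_div_hasSum_exp (-μ)).tendsto_sum_nat
    rw [← Real.exp_eq_exp_ℝ] at h1
    have h2 := (h1.comp (tendsto_add_atTop_nat 1)).mul_const (μ ^ t / t.factorial)
    rw [← mul_div_assoc] at h2
    refine h2.congr fun r => ?_
    simp only [Function.comp]
    rw [Finset.sum_mul]
    refine Finset.sum_congr rfl fun j _ => ?_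
    have : ((t.factorial : ℕ) : ℝ) ≠ 0 := by positivity
    have : ((j.factorial : ℕ) : ℝ) ≠ 0 := by positivity
    rw [neg_pow, pow_add]
    field_simp
  have hR : Tendsto (fun r : ℕ => μ ^ (t + (r + 1)) / (t.factorial * (r + 1).factorial)) atTop
      (𝓝 0) := by
    have h1 := ((FloorSemiring.tendsto_pow_div_factorial_atTop μ).comp
      (tendsto_add_atTop_nat 1)).const_mul (μ ^ t / t.factorial)
    rw [mul_zero] at h1
    refine h1.congr fun r => ?_
    simp only [Function.comp]
    rw [pow_add μ t]
    field_simp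
  rw [Metric.tendsto_nhds]
  intro ε hε
  -- The truncation r is fixed first, from the limiting moments alone; only finitely many moments
  -- then have to converge in n.
  obtain ⟨r, hr1, hr2⟩ := ((Metric.tendsto_nhds.1 hS (ε / 3) (by positivity)).and
    (hR.eventually_lt_const (by positivity : (0 : ℝ) < ε / 3))).exists
  have hSn : Tendsto (fun n => ∑ j ∈ Finset.range (r + 1),
      (-1) ^ j * (M (t + j) n / (t.factorial * j.factorial))) atTop
      (𝓝 (∑ j ∈ Finset.range (r + 1), (-1) ^ j * (μ ^ (t + j) / (t.factorial * j.factorial)))) :=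
    tendsto_finsetSum _ fun j _ => ((hM (t + j)).div_const _).const_mul _
  filter_upwards [Metric.tendsto_nhds.1 hSn (ε / 3) (by positivity),
    ((hM (t + (r + 1))).div_const _).eventually_lt_const hr2] with n hn1 hn2
  have h4 : dist (p n) (∑ j ∈ Finset.range (r + 1),
      (-1) ^ j * (M (t + j) n / (t.factorial * j.factorial))) < ε / 3 := by
    rw [Real.dist_eq]
    exact (hb n r).trans_lt hn2
  calc dist (p n) L ≤ _ := dist_triangle4 _ _ _ _
    _ < ε / 3 + ε / 3 + ε / 3 := add_lt_add (add_lt_add h4 hn1) hr1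
    _ = ε := by ring

/-! ### Expectations and the limit theorems. -/

namespace Multigraph

variable {V E : Type} {Δ : Polynomial ℝ}

lemma weight_nonneg [Fintype V] (hΔ : ∀ d, 0 ≤ Δ.coeff d) (G : Multigraph V E) :
    0 ≤ weight Δ G :=
  Finset.prod_nonneg fun _ _ => mul_nonneg (Nat.cast_nonneg _) (hΔ _)

lemma weight_div_nonneg (hΔ : ∀ d, 0 ≤ Δ.coeff d) {n m : ℕ} (G : Multigraph (Fin n) (Fin m)) :
    0 ≤ weight Δ G / totalWeight Δ n m :=
  div_nonneg (weight_nonneg hΔ G) (Finset.sum_nonneg fun _ _ => weight_nonneg hΔ _)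

lemma expect_mono (hΔ : ∀ d, 0 ≤ Δ.coeff d) {n m : ℕ} {f g : Multigraph (Fin n) (Fin m) → ℝ}
    (h : ∀ G, f G ≤ g G) : expect Δ n m f ≤ expect Δ n m g :=
  Finset.sum_le_sum fun G _ => mul_le_mul_of_nonneg_left (h G) (weight_div_nonneg hΔ G)

lemma expect_nonneg (hΔ : ∀ d, 0 ≤ Δ.coeff d) {n m : ℕ} {f : Multigraph (Fin n) (Fin m) → ℝ}
    (h : ∀ G, 0 ≤ f G) : 0 ≤ expect Δ n m f :=
  Finset.sum_nonneg fun G _ => mul_nonneg (weight_div_nonneg hΔ G) (h G)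

lemma abs_expect_le (hΔ : ∀ d, 0 ≤ Δ.coeff d) {n m : ℕ} (f : Multigraph (Fin n) (Fin m) → ℝ) :
    |expect Δ n m f| ≤ expect Δ n m fun G => |f G| := by
  refine (Finset.abs_sum_le_sum_abs _ _).trans (le_of_eq (Finset.sum_congr rfl fun G _ => ?_))
  rw [abs_mul, abs_of_nonneg (weight_div_nonneg hΔ G)]

lemma expect_add (n m : ℕ) (f g : Multigraph (Fin n) (Fin m) → ℝ) :
    expect Δ n m (fun G => f G + g G) = expect Δ n m f + expect Δ n m g := by
  simp only [expect, mul_add, Finset.sum_add_distrib]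

lemma expect_sub (n m : ℕ) (f g : Multigraph (Fin n) (Fin m) → ℝ) :
    expect Δ n m (fun G => f G - g G) = expect Δ n m f - expect Δ n m g := by
  simp only [expect, mul_sub, Finset.sum_sub_distrib]

lemma expect_const_mul (n m : ℕ) (a : ℝ) (f : Multigraph (Fin n) (Fin m) → ℝ) :
    expect Δ n m (fun G => a * f G) = a * expect Δ n m f := by
  simp only [expect, Finset.mul_sum]
  exact Finset.sum_congr rfl fun _ _ => by ring

lemma expect_sum {ι : Type*} (n m : ℕ) (s : Finset ι) (f : ι → Multigraph (Fin n) (Fin m) → ℝ) :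
    expect Δ n m (fun G => ∑ i ∈ s, f i G) = ∑ i ∈ s, expect Δ n m (f i) := by
  simp only [expect, Finset.mul_sum]
  exact Finset.sum_comm

lemma expect_count [Finite V] [Finite E] (n m : ℕ) (H : Multigraph V E) :
    expect Δ n m (fun G => (G.count H : ℝ)) =
      expect Δ n m (fun G => (Nat.card (Emb H G) : ℝ)) / Nat.card (Emb H H) := by
  have h : (Nat.card (Emb H H) : ℝ) ≠ 0 := by exact_mod_cast (card_emb_self_pos H).ne'
  rw [eq_div_iff h, mul_comm, ← expect_const_mul]
  congr 1
  funext G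
  rw [card_emb H G]
  push_cast
  ring

lemma prob_eq_expect (n m : ℕ) (p : Multigraph (Fin n) (Fin m) → Prop) [DecidablePred p] :
    prob Δ n m {G | p G} = expect Δ n m fun G => if p G then 1 else 0 := by
  rw [prob]
  congr 1
  funext G
  simp [Set.indicator_apply]

section Limits

variable {χ c : ℝ} {m : ℕ → ℕ}

lemma tendsto_atTop_of_ratio (hc : 0 < c)
    (hm : Tendsto (fun n : ℕ => 2 * (m n : ℝ) / n) atTop (𝓝 c)) : Tendsto m atTop atTop := by
  have h1 : Tendsto (fun n : ℕ => 2 * (m n : ℝ) / n * n) atTop atTop :=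
    hm.pos_mul_atTop hc tendsto_natCast_atTop_atTop
  have h2 : Tendsto (fun n : ℕ => 2 * (m n : ℝ)) atTop atTop := by
    refine h1.congr' ?_
    filter_upwards [eventually_gt_atTop 0] with n hn
    have : (n : ℝ) ≠ 0 := by positivity
    field_simp
  exact tendsto_natCast_atTop_iff.1 ((tendsto_const_mul_atTop_of_pos two_pos).1 h2)

lemma tendsto_ratio_pow (hc : 0 < c)
    (hm : Tendsto (fun n : ℕ => 2 * (m n : ℝ) / n) atTop (𝓝 c)) (k : ℕ) :
    Tendsto (fun n : ℕ => (n : ℝ) ^ k / (2 * (m n : ℝ)) ^ k) atTop (𝓝 ((1 / c) ^ k)) := by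
  refine ((hm.inv₀ hc.ne').pow k).congr' ?_ |>.trans (by rw [one_div])
  exact Eventually.of_forall fun n => by simp only [inv_div, div_pow]

lemma tendsto_ratio_zero (hc : 0 < c)
    (hm : Tendsto (fun n : ℕ => 2 * (m n : ℝ) / n) atTop (𝓝 c)) {k s : ℕ} (hks : k < s) :
    Tendsto (fun n : ℕ => (n : ℝ) ^ k / (2 * (m n : ℝ)) ^ s) atTop (𝓝 0) := by
  have hm' : Tendsto (fun n => 2 * (m n : ℝ)) atTop atTop :=
    (tendsto_natCast_atTop_atTop.comp (tendsto_atTop_of_ratio hc hm)).const_mul_atTop two_pos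
  have h1 := (tendsto_inv_atTop_zero.comp hm').pow (s - k)
  rw [zero_pow (by omega)] at h1
  have h2 := (tendsto_ratio_pow hc hm k).mul h1
  rw [mul_zero] at h2
  refine h2.congr fun n => ?_
  have : s = k + (s - k) := by omega
  conv_rhs => rw [this, pow_add]
  simp only [Function.comp]
  rw [inv_pow]
  ring

variable (hΔ : ∀ d, 0 ≤ Δ.coeff d) (haper : Δ.IsAperiodic) (h2 : Δ.support.Nontrivial)
  (hχ : 0 < χ) (hmean : Δ.tiltedMean χ = c) (hc : 0 < c)
  (hm : Tendsto (fun n : ℕ => 2 * (m n : ℝ) / n) atTop (𝓝 c))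

include hΔ haper h2 hχ hmean hc hm

/-- The expectation is O(n^(k-q)) with k < q. Connectedness plays no part, which matters because a
union of overlapping cycles may have several components. -/
lemma tendsto_expect_count_zero [Fintype V] [Fintype E] (H : Multigraph V E)
    (hH : Fintype.card V < Fintype.card E) :
    Tendsto (fun n : ℕ => expect Δ n (m n) fun G => (G.count H : ℝ)) atTop (𝓝 0) := by
  have h1 := (tendsto_expect_card_emb hΔ haper h2 hχ (hmean ▸ hm)
    (tendsto_atTop_of_ratio hc hm)).2 V E H
  have h3 := (h1.mul (tendsto_ratio_zero hc hm hH)).div_const (Nat.card (Emb H H) : ℝ)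
  rw [mul_zero, zero_div] at h3
  refine h3.congr' ?_
  filter_upwards [eventually_gt_atTop 0, (tendsto_atTop_of_ratio hc hm).eventually_gt_atTop 0]
    with n hn hn'
  rw [expect_count]
  have : (n : ℝ) ≠ 0 := by positivity
  have : (m n : ℝ) ≠ 0 := by positivity
  field_simp

/-- Connected multigraphs with more edges than vertices do not occur. -/
theorem tendsto_prob_count_zero [Fintype V] [Fintype E] (H : Multigraph V E)
    (hH : Fintype.card V < Fintype.card E) :
    Tendsto (fun n : ℕ => prob Δ n (m n) {G | 1 ≤ G.count H}) atTop (𝓝 0) := by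
  classical
  refine squeeze_zero (fun n => ?_) (fun n => ?_)
    (tendsto_expect_count_zero hΔ haper h2 hχ hmean hc hm H hH)
  · rw [prob_eq_expect]
    exact expect_nonneg hΔ fun G => by split_ifs <;> norm_num
  · rw [prob_eq_expect]
    refine expect_mono hΔ fun G => ?_
    split_ifs with h
    · exact_mod_cast h
    · positivity

/-- The expected number of copies of a tree. -/
theorem isEquivalent_expect_count_tree [Fintype V] [Fintype E] (T : Multigraph V E)
    (hT : T.IsTree) : Asymptotics.IsEquivalent atTop
      (fun n : ℕ => expect Δ n (m n) fun G => (G.count T : ℝ))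
      (fun n : ℕ => 1 / (T.aut : ℝ) *
        ((n : ℝ) ^ Fintype.card V / (2 * (m n : ℝ)) ^ (Fintype.card V - 1)) *
        vertexFactor Δ χ T) := by
  have hcard := hT.1.isTree_iff.1 hT
  have haut := card_emb_self_eq_aut T hT.no_loop
  have hm' := tendsto_atTop_of_ratio hc hm
  have hautpos : (T.aut : ℝ) ≠ 0 := by
    rw [← haut]; exact_mod_cast (card_emb_self_pos T).ne'
  have hE := Polynomial.eval_pos_of_coeff_nonneg hΔ h2.nonempty hχ
  have hk : Fintype.card V - 1 = Fintype.card E := by omega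
  rw [hk]
  by_cases h0 : vertexFactor Δ χ T = 0
  · have hz : ∃ v, Polynomial.derivative^[T.degree v] Δ = 0 := by
      rw [vertexFactor, Finset.prod_eq_zero_iff] at h0
      obtain ⟨v, -, hv⟩ := h0
      refine ⟨v, ?_⟩
      by_contra hne
      have hpos := Polynomial.eval_pos_of_coeff_nonneg (Δ := Polynomial.derivative^[T.degree v] Δ)
        (fun d => by rw [Polynomial.coeff_iterate_derivative]; exact nsmul_nonneg (hΔ _) _)
        (Polynomial.support_nonempty.2 hne) hχ
      have : 0 < χ ^ T.degree v * (Polynomial.derivative^[T.degree v] Δ).eval χ / Δ.eval χ := by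
        positivity
      exact this.ne' hv
    obtain ⟨v, hv⟩ := hz
    have hzero : ∀ n, expect Δ n (m n) (fun G => (G.count T : ℝ)) = 0 := by
      intro n
      rw [expect_count, expect]
      have h3 := sum_weight_mul_card_emb Δ n (m n) T
      rw [Finset.prod_eq_zero (Finset.mem_univ v) hv, zero_mul, Polynomial.iterate_derivative_zero,
        Polynomial.eval_zero, mul_zero] at h3
      simp_rw [div_mul_eq_mul_div]
      rw [← Finset.sum_div, h3, zero_div, zero_div]
    simp only [hzero, h0, mul_zero]
    exact Asymptotics.IsEquivalent.refl
  · have h1 := (tendsto_expect_card_emb hΔ haper h2 hχ (hmean ▸ hm) hm').2 V E T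
    have h3 := h1.div_const (vertexFactor Δ χ T)
    rw [div_self h0] at h3
    refine Asymptotics.isEquivalent_of_tendsto_one (h3.congr' ?_)
    filter_upwards [eventually_gt_atTop 0, hm'.eventually_gt_atTop 0] with n hn hn'
    rw [Pi.div_apply, expect_count, haut]
    have : (n : ℝ) ≠ 0 := by positivity
    have : (m n : ℝ) ≠ 0 := by positivity
    field_simp

/-- Domination by a fixed finite combination of first moments of multigraphs with more edges than
vertices. -/
lemma tendsto_expect_card_overlap (ℓ t : ℕ) :
    Tendsto (fun n : ℕ => expect Δ n (m n) fun G => (Nat.card {τ : Fin t → G.Copy (cycle (ℓ + 1)) //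
      Function.Injective τ ∧ ¬ DisjointTuple τ} : ℝ)) atTop (𝓝 0) := by
  set M := t * (ℓ + 1)
  set K : ℝ := (2 ^ M * 2 ^ M) ^ t
  have hlim : Tendsto (fun n : ℕ => K * ∑ s ∈ Finset.range (M + 1), ∑ k ∈ Finset.range s,
      ∑ F : Multigraph (Fin k) (Fin s), expect Δ n (m n) fun G => (G.count F : ℝ)) atTop
      (𝓝 (K * ∑ s ∈ Finset.range (M + 1), ∑ k ∈ Finset.range s,
        ∑ F : Multigraph (Fin k) (Fin s), 0)) := by
    refine (tendsto_finsetSum _ fun s _ => tendsto_finsetSum _ fun k hk =>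
      tendsto_finsetSum _ fun F _ => ?_).const_mul K
    exact tendsto_expect_count_zero hΔ haper h2 hχ hmean hc hm F
      (by simpa using Finset.mem_range.1 hk)
  simp only [Finset.sum_const_zero, mul_zero] at hlim
  refine squeeze_zero (fun n => expect_nonneg hΔ fun G => Nat.cast_nonneg _) (fun n => ?_) hlim
  simp_rw [← expect_sum]
  rw [← expect_const_mul]
  refine expect_mono hΔ fun G => ?_
  have h1 := (card_overlap_le G t ℓ).trans (Nat.mul_le_mul_left _ (card_denseSub_le G M))
  simp only [K]
  exact_mod_cast h1

/-- The factorial moments of the number of cycles of a given length converge. -/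
theorem tendsto_expect_descFactorial_count_cycle (ℓ t : ℕ) :
    Tendsto (fun n : ℕ => expect Δ n (m n) fun G =>
      ((G.count (cycle (ℓ + 1))).descFactorial t : ℝ)) atTop
      (𝓝 ((1 / (2 * ((ℓ + 1 : ℕ) : ℝ)) *
        (1 / c * (χ ^ 2 * (Polynomial.derivative^[2] Δ).eval χ / Δ.eval χ)) ^ (ℓ + 1)) ^ t)) := by
  set L := χ ^ 2 * (Polynomial.derivative^[2] Δ).eval χ / Δ.eval χ
  have hm' := tendsto_atTop_of_ratio hc hm
  have h1 := (tendsto_expect_card_emb hΔ haper h2 hχ (hmean ▸ hm) hm').2 _ _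
    (copies t (cycle (ℓ + 1)))
  have hvf : vertexFactor Δ χ (copies t (cycle (ℓ + 1))) = L ^ (t * (ℓ + 1)) := by
    simp only [vertexFactor, degree_copies_cycle, Finset.prod_const, Finset.card_univ,
      Fintype.card_prod, Fintype.card_fin]
    rfl
  rw [hvf] at h1
  simp only [Fintype.card_prod, Fintype.card_fin] at h1
  -- The copies have as many edges as vertices, so the power of n/(2m) has a positive limit; the
  -- divisor removes the 2(ℓ + 1) symmetries of each cycle.
  have h3 := ((h1.mul (tendsto_ratio_pow hc hm (t * (ℓ + 1)))).div_const
    ((2 * ((ℓ + 1 : ℕ) : ℝ)) ^ t)).add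
    (tendsto_expect_card_overlap hΔ haper h2 hχ hmean hc hm ℓ t)
  have hval : L ^ (t * (ℓ + 1)) * (1 / c) ^ (t * (ℓ + 1)) / (2 * ((ℓ + 1 : ℕ) : ℝ)) ^ t + 0 =
      (1 / (2 * ((ℓ + 1 : ℕ) : ℝ)) * (1 / c * L) ^ (ℓ + 1)) ^ t := by
    rw [add_zero, ← mul_pow, mul_comm t, pow_mul, ← div_pow, mul_comm L]
    ring
  rw [hval] at h3
  refine h3.congr' ?_
  filter_upwards [eventually_gt_atTop 0, hm'.eventually_gt_atTop 0] with n hn hn'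
  have : (n : ℝ) ≠ 0 := by positivity
  have : (m n : ℝ) ≠ 0 := by positivity
  have hne : (2 * ((ℓ + 1 : ℕ) : ℝ)) ^ t ≠ 0 := by positivity
  have h4 : (fun G : Multigraph (Fin n) (Fin (m n)) =>
      ((G.count (cycle (ℓ + 1))).descFactorial t : ℝ)) = fun G =>
      ((2 * ((ℓ + 1 : ℕ) : ℝ)) ^ t)⁻¹ * (Nat.card (Emb (copies t (cycle (ℓ + 1))) G) : ℝ) +
      (Nat.card {τ : Fin t → G.Copy (cycle (ℓ + 1)) //
        Function.Injective τ ∧ ¬ DisjointTuple τ} : ℝ) := by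
    funext G
    rw [descFactorial_count, card_emb_copies, card_emb_cycle_self]
    push_cast at hne ⊢
    field_simp
  rw [h4, expect_add, expect_const_mul]
  field_simp

/-- The number of cycles of a given length is asymptotically Poisson. -/
theorem tendsto_prob_count_cycle (ℓ t : ℕ) {μ : ℝ}
    (hμ : μ = 1 / (2 * ((ℓ + 1 : ℕ) : ℝ)) *
      (1 / c * (χ ^ 2 * (Polynomial.derivative^[2] Δ).eval χ / Δ.eval χ)) ^ (ℓ + 1)) :
    Tendsto (fun n : ℕ => prob Δ n (m n) {G | G.count (cycle (ℓ + 1)) = t}) atTop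
      (𝓝 (Real.exp (-μ) * μ ^ t / t.factorial)) := by
  refine tendsto_poisson_of_bonferroni (M := fun j n => expect Δ n (m n) fun G =>
    ((G.count (cycle (ℓ + 1))).descFactorial j : ℝ)) t (fun j => ?_) fun n r => ?_
  · rw [hμ]
    exact tendsto_expect_descFactorial_count_cycle hΔ haper h2 hχ hmean hc hm ℓ j
  · rw [prob_eq_expect]
    simp only [div_eq_inv_mul, ← expect_const_mul]
    rw [← expect_sum, ← expect_sub]
    refine (abs_expect_le hΔ _).trans (expect_mono hΔ fun G => ?_)
    have h := abs_indicator_sub_sum_choose_le (G.count (cycle (ℓ + 1))) t r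
    simp only [choose_mul_choose_eq, div_eq_inv_mul] at h
    exact h

end Limits

end Multigraph

theorem mainTheorem8 (Δ : Polynomial ℝ) (hΔ : ∀ d : ℕ, 0 ≤ Δ.coeff d) (haper : Δ.IsAperiodic)
    (m : ℕ → ℕ) (c : ℝ)
    (hm : Filter.Tendsto (fun n : ℕ => 2 * (m n : ℝ) / (n : ℝ)) Filter.atTop (nhds c))
    (hmin : ∃ a ∈ Δ.support, (a : ℝ) < c) (hmax : ∃ b ∈ Δ.support, c < (b : ℝ)) :
    -- the saddle point exists and is unique
    (∃! χ : ℝ, 0 < χ ∧ χ * Δ.derivative.eval χ / Δ.eval χ = c) ∧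
    -- for large `n` the random multigraph is well defined
    (∀ᶠ n : ℕ in Filter.atTop, 0 < Multigraph.totalWeight Δ n (m n)) ∧
    -- (i)
    (∀ (V E : Type) [Fintype V] [Fintype E] (H : Multigraph V E),
      H.Connected → ¬ H.IsTree → ¬ H.IsUnicycle →
      Filter.Tendsto (fun n : ℕ => Multigraph.prob Δ n (m n) {G | 1 ≤ G.count H})
        Filter.atTop (nhds 0)) ∧
    ∀ χ : ℝ, 0 < χ → χ * Δ.derivative.eval χ / Δ.eval χ = c →
      -- (ii)
      (∀ (V E : Type) [Fintype V] [Fintype E] (T : Multigraph V E), T.IsTree →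
        Asymptotics.IsEquivalent Filter.atTop
          (fun n : ℕ => Multigraph.expect Δ n (m n) fun G => (G.count T : ℝ))
          (fun n : ℕ => 1 / (T.aut : ℝ) *
            ((n : ℝ) ^ Fintype.card V / (2 * (m n : ℝ)) ^ (Fintype.card V - 1)) *
            ∏ v : V, χ ^ T.degree v *
              (Polynomial.derivative^[T.degree v] Δ).eval χ / Δ.eval χ)) ∧
      -- (iii)
      (∀ ℓ : ℕ, 1 ≤ ℓ → ∀ μ : ℝ,
        μ = 1 / (2 * (ℓ : ℝ)) *
          (1 / c * (χ ^ 2 * (Polynomial.derivative^[2] Δ).eval χ / Δ.eval χ)) ^ ℓ →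
        ∀ t : ℕ, Filter.Tendsto
          (fun n : ℕ => Multigraph.prob Δ n (m n) {G | G.count (Multigraph.cycle ℓ) = t})
          Filter.atTop (nhds (Real.exp (-μ) * μ ^ t / (t.factorial : ℝ)))) := by
  have h2 := Polynomial.support_nontrivial hmin hmax
  have hc : 0 < c := by
    obtain ⟨a, -, ha⟩ := hmin
    exact (Nat.cast_nonneg a).trans_lt ha
  have hex := Polynomial.existsUnique_tiltedMean_eq hΔ hmin hmax
  -- Well-definedness and (i) do not mention χ, but their proofs need some saddle point.
  obtain ⟨χ₀, ⟨hχ₀, hmean₀⟩, -⟩ := hex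
  refine ⟨Polynomial.existsUnique_tiltedMean_eq hΔ hmin hmax, ?_, ?_, ?_⟩
  · exact (Multigraph.tendsto_expect_card_emb hΔ haper h2 hχ₀ (hmean₀ ▸ hm)
      (Multigraph.tendsto_atTop_of_ratio hc hm)).1
  · intro V E _ _ H hH hT hU
    exact Multigraph.tendsto_prob_count_zero hΔ haper h2 hχ₀ hmean₀ hc hm H (hH.card_lt hT hU)
  · intro χ hχ hmean
    refine ⟨fun V E _ _ T hT => ?_, fun ℓ hℓ μ hμ t => ?_⟩
    · exact Multigraph.isEquivalent_expect_count_tree hΔ haper h2 hχ hmean hc hm T hT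
    · obtain ⟨ℓ, rfl⟩ := Nat.exists_eq_add_of_le' hℓ
      exact Multigraph.tendsto_prob_count_cycle hΔ haper h2 hχ hmean hc hm ℓ t hμ
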